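/- Let $M$ be a field of characteristic $\neq 2$ with algebraic closure $\overline M$. For $\mathbf a=(a,b)\in M^2$ put $f_{\mathbf a}=X^4+aX^2+bX+b$, let $L_{\mathbf a}\subset\overline M$ be its splitting field over $M$ and $G_{\mathbf a}=\mathrm{Gal}(L_{\mathbf a}/M)$. Let $\mathbf a=(a,b)$, $\mathbf a'=(a',b')\in M^2$ be such that $f_{\mathbf a}$ and $f_{\mathbf a'}$ are separable and irreducible over $M$, $\#G_{\mathbf a}\ge\#G_{\mathbf a'}$, and $G_{\mathbf a}\cong S_4$ or $G_{\mathbf a}\cong A_4$. Let $G_{\mathbf a,\mathbf a'}=\mathrm{Gal}(L_{\mathbf a}L_{\mathbf a'}/M)$ be the Galois group of $f_{\mathbf a}f_{\mathbf a'}$. For separable monic quartics $f,g\in M[X]$ with roots $\alpha_1,\dots,\alpha_4$ and $\beta_1,\dots,\beta_4$ in $\overline M$, the multi-resolvent built from $P=\sum_i x_iy_i$ is $R_{f,g}(X)=\prod_{\pi\in S_4}\bigl(X-\sum_{i=1}^4\alpha_i\beta_{\pi(i)}\bigr)$. A Tschirnhausen transformation of $f$ over $M$ is a separable polynomial $\prod_i(X-c(\alpha_i))$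 with $c\in M[X]$, $\deg c<4$. The decomposition type of $R_{f,g}$ over $M$ is the partition of $24$ formed by the degrees of the irreducible factors over $M$ of $R_{\hat f,\hat g}$, where $\hat f,\hat g$ are Tschirnhausen transformations of $f,g$ over $M$ for which $R_{\hat f,\hat g}$ has no repeated factors (one may take $\hat f=f$, $\hat g=g$ if $R_{f,g}$ has none). Then $R_{\mathbf a,\mathbf a'}:=R_{f_{\mathbf a},f_{\mathbf a'}}$ is a polynomial of degree $24$ in $M[X]$; its decomposition type $\mathrm{DT}$ exists and does not depend on the choice of the transformations; and exactly one row of the following table is correct in all its entries. $$\begin{array}{r|c|c|c|c|c} & G_{\mathbf a} & G_{\mathbf a'} & G_{\mathbf a,\mathbf a'} & L_{\mathbf a}\cap L_{\mathbf a'} & \mathrm{DT}\\\hline 1&S_4&S_4&S_4\times S_4& =M&24\\ 2&S_4&S_4&(A_4\times A_4)\rtimes C_2&\text{degree }2&12,12\\ 3&S_4&S_4&(V_4\times V_4)\rtimes S_3&\text{degree }6&12,8,4\\ 4&S_4&S_4&S_4&L_{\mathbf a}=L_{\mathbf a'}&8,6,6,3,1\\ 5&S_4&A_4&S_4\times A_4&=M&24\\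 6&S_4&D_4&S_4\times D_4&=M&24\\ 7&S_4&D_4&(A_4\times C_4)\rtimes C_2&\text{degree }2&24\\ 8&S_4&D_4&(A_4\times V_4)\rtimes C_2&\text{degree }2&24\\ 9&S_4&D_4&(A_4\times V_4)\rtimes C_2&\text{degree }2&12,12\\ 10&S_4&C_4&S_4\times C_4&L_{\mathbf a}\ne L_{\mathbf a'},\ =M&24\\ 11&S_4&C_4&A_4\rtimes C_4&\text{degree }2&12,12\\ 12&S_4&V_4&S_4\times V_4&L_{\mathbf a}\ne L_{\mathbf a'},\ =M&24\\ 13&S_4&V_4&S_4\times C_2&\text{degree }2&24\\ 14&A_4&A_4&A_4\times A_4&=M&12,12\\ 15&A_4&A_4&(V_4\times V_4)\rtimes C_3&\text{degree }3&12,4,4,4\\ 16&A_4&A_4&A_4&L_{\mathbf a}=L_{\mathbf a'}&6,6,4,4,3,1\\ 17&A_4&D_4&A_4\times D_4&=M&24\\ 18&A_4&C_4&A_4\times C_4&=M&24\\ 19&A_4&V_4&A_4\times V_4&=M&12,12 \end{array}$$ Group entries are up to isomorphism; "degree" is $[L_{\mathbf a}\cap L_{\mathbf a'}:M]$; $D_4$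 has order $8$, $V_4$ is the normal Klein four-group of $S_4$. In row 2, $C_2$ acts on both copies of $A_4$ by conjugation with a transposition; in rows 3 and 15, $S_3$ (the stabilizer of a point) and $C_3$ (generated by a 3-cycle) act diagonally by conjugation in $S_4$; in rows 7, 8, 9, $C_2$ acts on $A_4$ by conjugation with a transposition, on $C_4$ by inversion, and on $V_4$ by exchanging two involutions; in row 11, a generator of $C_4$ acts on $A_4$ by conjugation with a transposition. Moreover, if $G_{\mathbf a}$, $G_{\mathbf a'}$ and $\mathrm{DT}$ are as in a row other than rows 6, 7, 8, 12, 13, then that row is the correct one; so $G_{\mathbf a}$, $G_{\mathbf a'}$ and $\mathrm{DT}$ determine the row except for the ambiguities $\{6,7,8\}$ and $\{12,13\}$. -/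

import Mathlib

open Polynomial

namespace QuarticIntersection

/-! ### The groups occurring in the table -/

/-- The symmetric group `S₄`, acting on `{0, 1, 2, 3}`. -/
abbrev S4 : Type := Equiv.Perm (Fin 4)

/-- The alternating group `A₄`, as a subgroup of `S₄`. -/
abbrev A4 : Subgroup S4 := alternatingGroup (Fin 4)

/-- The normal Klein four-group `V₄` of `S₄`: the identity and the three double transpositions. -/
def V4 : Subgroup S4 where
  carrier := {g | g = 1 ∨ g = Equiv.swap 0 1 * Equiv.swap 2 3 ∨
    g = Equiv.swap 0 2 * Equiv.swap 1 3 ∨ g = Equiv.swap 0 3 * Equiv.swap 1 2}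
  one_mem' := Or.inl rfl
  mul_mem' := by
    rintro a b (rfl | rfl | rfl | rfl) (rfl | rfl | rfl | rfl) <;>
      simp only [Set.mem_ofPred_eq] <;> decide
  inv_mem' := by
    rintro a (rfl | rfl | rfl | rfl) <;> simp only [Set.mem_ofPred_eq] <;> decide

instance V4_normal : V4.Normal where
  conj_mem := by
    rintro n (rfl | rfl | rfl | rfl) g
    · exact Or.inl (by simp)
    all_goals
      change _ ∨ _ ∨ _ ∨ _
      revert g
      decide

/-- The 4-cycle `0 ↦ 1 ↦ 2 ↦ 3 ↦ 0`. -/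
def fourCycle : S4 := finRotate 4

/-- The transposition of `0` and `2`, which inverts `fourCycle`. -/
def reflection : S4 := Equiv.swap 0 2

/-- The transposition of `0` and `1`. -/
def transposition : S4 := Equiv.swap 0 1

/-- The 3-cycle `0 ↦ 1 ↦ 2 ↦ 0`. -/
def threeCycle : S4 := Equiv.swap 0 1 * Equiv.swap 1 2

/-- The cyclic group `C₄`, as a subgroup of `S₄`. -/
abbrev C4 : Subgroup S4 := Subgroup.zpowers fourCycle

/-- The stabilizer of the point `3` in `S₄`, a copy of `S₃`. -/
abbrev S3 : Subgroup S4 := MulAction.stabilizer S4 (3 : Fin 4)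

/-- The external semidirect product `N ⋊ Q` of two subgroups of a group in which `Q` normalizes
`N`, where `Q` acts on `N` by conjugation. -/
abbrev ConjSemidirect {G : Type*} [Group G] (N Q : Subgroup G)
    (h : Q ≤ Subgroup.normalizer (N : Set G)) : Type _ :=
  SemidirectProduct N Q (N.normalizerMonoidHom.comp (Subgroup.inclusion h))

theorem le_normalizer_of_normal {G : Type*} [Group G] (N Q : Subgroup G) [N.Normal] :
    Q ≤ Subgroup.normalizer (N : Set G) := by
  rw [Subgroup.normalizer_eq_top]; exact le_top

theorem reflection_normalizes :
    Subgroup.zpowers ((transposition, reflection) : S4 × S4) ≤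
      Subgroup.normalizer ((A4.prod C4 : Subgroup (S4 × S4)) : Set (S4 × S4)) := by
  have key : ∀ h : S4, h ∈ C4 → reflection * h * reflection⁻¹ ∈ C4 := by
    rintro h ⟨n, rfl⟩
    refine ⟨-n, ?_⟩
    have : reflection * fourCycle * reflection⁻¹ = fourCycle⁻¹ := by decide
    simp only [zpow_neg, ← conj_zpow, this, inv_zpow]
  have hr : reflection⁻¹ = reflection := by decide
  rw [Subgroup.zpowers_le, Subgroup.mem_normalizer_iff]
  rintro ⟨g, h⟩
  simp only [Subgroup.mem_prod, Prod.mk_mul_mk, Prod.inv_mk]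
  refine and_congr (by simp [Equiv.Perm.mem_alternatingGroup, transposition]) ⟨key h, fun hh => ?_⟩
  have := key _ hh
  simpa [hr, mul_assoc, show reflection * reflection = 1 by decide,
    ← mul_assoc reflection reflection] using this

/-- `(A₄ × A₄) ⋊ C₂`, with `C₂` acting by conjugation with an odd permutation on both factors. -/
abbrev A4A4_C2 : Type :=
  ConjSemidirect (A4.prod A4) (Subgroup.zpowers ((transposition, transposition) : S4 × S4))
    (le_normalizer_of_normal _ _)

/-- `(V₄ × V₄) ⋊ S₃`, with `S₃` acting diagonally by conjugation. -/
abbrev V4V4_S3 : Type :=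
  ConjSemidirect (V4.prod V4) (S3.map ((MonoidHom.id S4).prod (MonoidHom.id S4)))
    (le_normalizer_of_normal _ _)

/-- `(V₄ × V₄) ⋊ C₃`, with `C₃` acting diagonally by conjugation. -/
abbrev V4V4_C3 : Type :=
  ConjSemidirect (V4.prod V4) (Subgroup.zpowers ((threeCycle, threeCycle) : S4 × S4))
    (le_normalizer_of_normal _ _)

/-- `(A₄ × C₄) ⋊ C₂`, with `C₂` acting on `A₄` by conjugation with an odd permutation and on `C₄`
by inversion. -/
abbrev A4C4_C2 : Type :=
  ConjSemidirect (A4.prod C4) (Subgroup.zpowers ((transposition, reflection) : S4 × S4))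
    reflection_normalizes

/-- `(A₄ × V₄) ⋊ C₂`, with `C₂` acting on `A₄` by conjugation with an odd permutation and on `V₄`
by exchanging two of its involutions. -/
abbrev A4V4_C2 : Type :=
  ConjSemidirect (A4.prod V4) (Subgroup.zpowers ((transposition, reflection) : S4 × S4))
    (le_normalizer_of_normal _ _)

/-- `A₄ ⋊ C₄`, with a generator of `C₄` acting on `A₄` by conjugation with a transposition. -/
abbrev A4_C4 : Type :=
  ConjSemidirect (A4.prod (⊥ : Subgroup S4))
    (Subgroup.zpowers ((transposition, fourCycle) : S4 × S4))
    (le_normalizer_of_normal _ _)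

/-- The isomorphism types of the transitive subgroups of `S₄`. -/
inductive QuarticType
  | S4 | A4 | D4 | C4 | V4

/-- The group `G` is of the given type. -/
def QuarticType.Is (G : Type*) [Group G] : QuarticType → Prop
  | .S4 => Nonempty (G ≃* QuarticIntersection.S4)
  | .A4 => Nonempty (G ≃* QuarticIntersection.A4)
  | .D4 => Nonempty (G ≃* DihedralGroup 4)
  | .C4 => Nonempty (G ≃* QuarticIntersection.C4)
  | .V4 => Nonempty (G ≃* QuarticIntersection.V4)

/-! ### The table -/

/-- The rows of the table. -/
inductive TableRow
  | row01 | row02 | row03 | row04 | row05 | row06 | row07 | row08 | row09 | row10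
  | row11 | row12 | row13 | row14 | row15 | row16 | row17 | row18 | row19

namespace TableRow

/-- First column: the Galois group of the first quartic. -/
def first : TableRow → QuarticType
  | row01 | row02 | row03 | row04 | row05 | row06 | row07 | row08 | row09 | row10
  | row11 | row12 | row13 => .S4
  | row14 | row15 | row16 | row17 | row18 | row19 => .A4

/-- Second column: the Galois group of the second quartic. -/
def second : TableRow → QuarticType
  | row01 | row02 | row03 | row04 => .S4
  | row05 => .A4
  | row06 | row07 | row08 | row09 => .D4
  | row10 | row11 => .C4
  | row12 | row13 => .V4
  | row14 | row15 | row16 => .A4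
  | row17 => .D4
  | row18 => .C4
  | row19 => .V4

/-- Third column: the group `G` is isomorphic to the Galois group of the product of the two
quartics listed in the row. -/
def HasProductGroup (G : Type*) [Group G] : TableRow → Prop
  | row01 => Nonempty (G ≃* S4 × S4)
  | row02 => Nonempty (G ≃* A4A4_C2)
  | row03 => Nonempty (G ≃* V4V4_S3)
  | row04 => Nonempty (G ≃* S4)
  | row05 => Nonempty (G ≃* S4 × A4)
  | row06 => Nonempty (G ≃* S4 × DihedralGroup 4)
  | row07 => Nonempty (G ≃* A4C4_C2)
  | row08 => Nonempty (G ≃* A4V4_C2)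
  | row09 => Nonempty (G ≃* A4V4_C2)
  | row10 => Nonempty (G ≃* S4 × C4)
  | row11 => Nonempty (G ≃* A4_C4)
  | row12 => Nonempty (G ≃* S4 × V4)
  | row13 => Nonempty (G ≃* S4 × Multiplicative (ZMod 2))
  | row14 => Nonempty (G ≃* A4 × A4)
  | row15 => Nonempty (G ≃* V4V4_C3)
  | row16 => Nonempty (G ≃* A4)
  | row17 => Nonempty (G ≃* A4 × DihedralGroup 4)
  | row18 => Nonempty (G ≃* A4 × C4)
  | row19 => Nonempty (G ≃* A4 × V4)

/-- Fourth column: the intersection of the two splitting fields. -/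
def HasIntersection {M Ω : Type*} [Field M] [Field Ω] [Algebra M Ω]
    (L L' : IntermediateField M Ω) : TableRow → Prop
  | row01 | row05 | row06 | row14 | row17 | row18 | row19 => L ⊓ L' = ⊥
  | row10 | row12 => L ≠ L' ∧ L ⊓ L' = ⊥
  | row02 | row07 | row08 | row09 | row11 | row13 =>
      Module.finrank M (L ⊓ L' : IntermediateField M Ω) = 2
  | row15 => Module.finrank M (L ⊓ L' : IntermediateField M Ω) = 3
  | row03 => Module.finrank M (L ⊓ L' : IntermediateField M Ω) = 6
  | row04 | row16 => L = L'

/-- Last column: the decomposition type of the multi-resolvent. -/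
def decType : TableRow → Multiset ℕ
  | row01 => {24}
  | row02 => {12, 12}
  | row03 => {12, 8, 4}
  | row04 => {8, 6, 6, 3, 1}
  | row05 => {24}
  | row06 => {24}
  | row07 => {24}
  | row08 => {24}
  | row09 => {12, 12}
  | row10 => {24}
  | row11 => {12, 12}
  | row12 => {24}
  | row13 => {24}
  | row14 => {12, 12}
  | row15 => {12, 4, 4, 4}
  | row16 => {6, 6, 4, 4, 3, 1}
  | row17 => {24}
  | row18 => {24}
  | row19 => {12, 12}

end TableRow

/-! ### The quartics, their splitting fields and the multi-resolvent -/

section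

variable {M : Type*} [Field M]

/-- The quartic `X⁴ + aX² + bX + b`. -/
noncomputable def quartic (a b : M) : M[X] := X ^ 4 + C a * X ^ 2 + C b * X + C b

/-- The splitting field of `f` inside an extension `Ω` (an algebraic closure in what follows). -/
def splittingFieldIn (Ω : Type*) [Field Ω] [Algebra M Ω] (f : M[X]) : IntermediateField M Ω :=
  IntermediateField.adjoin M (f.rootSet Ω)

variable {Ω : Type*} [Field Ω] [Algebra M Ω]

/-- `α` is an ordering of the roots of the monic polynomial `f` of degree `n` in `Ω`. -/
def IsRootOrdering {n : ℕ} (f : M[X]) (α : Fin n → Ω) : Prop :=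
  f.map (algebraMap M Ω) = ∏ i, (X - C (α i))

/-- The product of `X - π(P)(α, β)` where `P = x₀y₀ + x₁y₁ + x₂y₂ + x₃y₃` and `π` runs through
the elements `(1, π)` of `S₄ × S₄`. These represent the cosets of the stabilizer of `P` in
`S₄ × S₄`, which is the diagonal copy of `S₄`. -/
noncomputable def rootResolvent (α β : Fin 4 → Ω) : Polynomial Ω :=
  ∏ π : S4, (X - C (∑ i, α i * β (π i)))

variable (Ω) in
/-- `R`, a polynomial over `M`, is the multi-resolvent of the monic quartics `f` and `g`. -/
def IsMultiResolvent (f g R : M[X]) : Prop :=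
  ∃ α β : Fin 4 → Ω, IsRootOrdering f α ∧ IsRootOrdering g β ∧
    R.map (algebraMap M Ω) = rootResolvent α β

variable (Ω) in
/-- `g` is a Tschirnhausen transformation of `f` over `M`: it is separable, and its roots are the
values of a polynomial `c` over `M` of degree less than `deg f` at the roots of `f`. -/
def IsTschirnhausen (f g : M[X]) : Prop :=
  g.Separable ∧ ∃ c : M[X], c.degree < f.degree ∧
    ∃ α : Fin f.natDegree → Ω, IsRootOrdering f α ∧ IsRootOrdering g (fun i => aeval (α i) c)

/-- The degrees, with multiplicity, of the irreducible factors over `M` of a polynomial. -/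
noncomputable def factorDegrees (R : M[X]) : Multiset ℕ :=
  (UniqueFactorizationMonoid.factors R).map natDegree

variable (Ω) in
/-- `D` is a decomposition type over `M` of the multi-resolvent of the quartics `f` and `g`: the
partition of 24 given by the degrees of the irreducible factors of the multi-resolvent of `f'`
and `g'`, where `f'` and `g'` are Tschirnhausen transformations of `f` and `g` over `M` chosen in
such a way that this resolvent has no repeated factors (the choice `f' = f`, `g' = g` is permitted
when the multi-resolvent of `f` and `g` itself has no repeated factors). -/
def IsDecompositionType (f g : M[X]) (D : Multiset ℕ) : Prop :=
  ∃ f' g' R : M[X], IsTschirnhausen Ω f f' ∧ IsTschirnhausen Ω g g' ∧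
    IsMultiResolvent Ω f' g' R ∧ Squarefree R ∧ factorDegrees R = D

variable (Ω) in
/-- All entries of the row `r` are correct for the quartics `f` and `g`, with `D` as the
decomposition type of their multi-resolvent. -/
def TableRow.Holds (f g : M[X]) (D : Multiset ℕ) (r : TableRow) : Prop :=
  r.first.Is f.Gal ∧ r.second.Is g.Gal ∧ r.HasProductGroup (f * g).Gal ∧
    r.HasIntersection (splittingFieldIn Ω f) (splittingFieldIn Ω g) ∧ r.decType = D

end

end QuarticIntersection

open QuarticIntersection

namespace QuarticIntersection

/-! ### Subgroups of `S₄` -/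

/-! Number the roots of the two quartics `f` and `g`. The automorphisms of `Ω` over `M` permute both
sets of roots, which gives a homomorphism to `S₄ × S₄` with image `H`. Its two projections are the
Galois groups of `f` and `g`, and `H` itself is that of `f * g`. An automorphism acting by `(σ, τ)`
sends the root of the resolvent with index `π` to the one with index `τ π σ⁻¹`. When the resolvent
is squarefree its roots are distinct, so its irreducible factors correspond to the orbits of `H` on
`S₄`. The degree of `L ∩ L'` is the product of the orders of the projections divided by the order of
`H`. Hence every entry of a row can be read off from `H`, and renumbering the roots of `g` changes
nothing (`Fits.of_relabel`).

It remains to classify `H` in the manner of Goursat (`exists_fits_of_projections`). The left part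
`{σ | (σ, 1) ∈ H}` is normal in the first projection, which is `S₄` or `A₄`, so it is `1`, `V₄`,
`A₄` or `S₄`. If it is the whole projection, `H` is a direct product. If it is `A₄` inside `S₄`,
then `H` is determined by a subgroup of index 2 of the second projection. If it is `1` or `V₄`,
counting shows that both projections have the same order and that the right part equals the left
part. The isomorphism of quotients defining `H` is then conjugation by an element of `S₄`, so after
renumbering `H` contains the diagonal. When `A₄` lies in the left part, the orbits are all of `S₄`
or the two classes of the sign. In the diagonal cases they are conjugacy classes modulo `V₄` or
modulo `1`. The finite checks in `S₄` are done by `decide`.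

A decomposition type exists because `M` is infinite, a finite field having only cyclic Galois
groups. A suitable transformation then lies outside finitely many proper subspaces
(`exists_tschirnhausen_poly`). Uniqueness of the row compares the group types, the decomposition
type and the degree of the intersection. Only rows 7 and 8 share all of these, and they differ by an
element of order 12 in the group of the product. -/

instance decidableMemV4 : DecidablePred (· ∈ V4) := fun g =>
  inferInstanceAs (Decidable (g = 1 ∨ g = Equiv.swap 0 1 * Equiv.swap 2 3 ∨
    g = Equiv.swap 0 2 * Equiv.swap 1 3 ∨ g = Equiv.swap 0 3 * Equiv.swap 1 2))

instance decidableMemA4 : DecidablePred (· ∈ A4) := fun _ =>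
  decidable_of_iff _ (Equiv.Perm.mem_alternatingGroup).symm

/-- The double transposition `(0 2)(1 3)`, the square of `fourCycle`. -/
def halfTurn : S4 := Equiv.swap 0 2 * Equiv.swap 1 3

/-- The dihedral subgroup of order 8 generated by `fourCycle` and `reflection`. -/
def D4 : Subgroup S4 where
  carrier := {g | g * halfTurn = halfTurn * g}
  one_mem' := by simp
  mul_mem' := by
    intro a b ha hb
    simp only [Set.mem_ofPred_eq] at *
    rw [mul_assoc, hb, ← mul_assoc, ha, mul_assoc]
  inv_mem' := by
    intro a ha
    simp only [Set.mem_ofPred_eq] at *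
    rw [inv_mul_eq_iff_eq_mul, ← mul_assoc, ha, mul_assoc, mul_inv_cancel, mul_one]

theorem mem_D4 {g : S4} : g ∈ D4 ↔ g * halfTurn = halfTurn * g := Iff.rfl

instance decidableMemD4 : DecidablePred (· ∈ D4) := fun _ => decidable_of_iff _ mem_D4.symm

theorem fourCycle_pow_four : fourCycle ^ 4 = 1 := by decide

theorem orderOf_fourCycle : orderOf fourCycle = 4 :=
  orderOf_eq_prime_pow (p := 2) (n := 1) (by decide) fourCycle_pow_four

theorem mem_C4 {g : S4} :
    g ∈ C4 ↔ g = 1 ∨ g = fourCycle ∨ g = fourCycle ^ 2 ∨ g = fourCycle ^ 3 := by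
  constructor
  · intro h
    obtain ⟨n, hn, rfl⟩ := Finset.mem_image.1 (mem_zpowers_iff_mem_range_orderOf.1 h)
    rw [orderOf_fourCycle, Finset.mem_range] at hn
    interval_cases n <;> simp
  · rintro (rfl | rfl | rfl | rfl)
    exacts [one_mem _, Subgroup.mem_zpowers _, pow_mem (Subgroup.mem_zpowers _) _,
      pow_mem (Subgroup.mem_zpowers _) _]

instance decidableMemC4 : DecidablePred (· ∈ C4) := fun _ => decidable_of_iff _ mem_C4.symm

theorem card_subgroup_eq (G : Subgroup S4) [DecidablePred (· ∈ G)] :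
    Nat.card G = (Finset.univ.filter (· ∈ G)).card := by
  rw [Nat.card_eq_fintype_card, Fintype.card_subtype]

theorem card_S4 : Nat.card S4 = 24 := by
  rw [Nat.card_eq_fintype_card]; decide

theorem card_A4 : Nat.card A4 = 12 := by
  rw [card_subgroup_eq]; decide

theorem card_V4 : Nat.card V4 = 4 := by
  rw [card_subgroup_eq]; decide

theorem card_C4 : Nat.card C4 = 4 := by
  rw [card_subgroup_eq]; decide

theorem card_D4 : Nat.card D4 = 8 := by
  rw [card_subgroup_eq]; decide

theorem V4_le_A4 : V4 ≤ A4 := by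
  have : ∀ g ∈ V4, g ∈ A4 := by decide
  exact this

/-- The conjugate `t⁻¹ G t`. -/
abbrev conjBy {G : Type*} [Group G] (t : G) (N : Subgroup G) : Subgroup G :=
  N.comap (MulAut.conj t).toMonoidHom

theorem mem_conjBy {G : Type*} [Group G] {t : G} {N : Subgroup G} {g : G} :
    g ∈ conjBy t N ↔ t * g * t⁻¹ ∈ N := Iff.rfl

theorem card_conjBy {G : Type*} [Group G] (t : G) (N : Subgroup G) :
    Nat.card (conjBy t N) = Nat.card N :=
  Nat.card_congr ((MulAut.conj t).toEquiv.subtypeEquiv fun _ => Iff.rfl)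

theorem conjBy_of_normal {G : Type*} [Group G] (t : G) (N : Subgroup G) [hN : N.Normal] :
    conjBy t N = N := by
  ext g
  refine ⟨fun h => ?_, fun h => hN.conj_mem _ h _⟩
  have := hN.conj_mem _ h t⁻¹
  simpa [mul_assoc] using this

theorem mem_A4_iff_mem_A4 {x y : S4} :
    (x ∈ A4 ↔ y ∈ A4) ↔ Equiv.Perm.sign x = Equiv.Perm.sign y := by
  rw [Equiv.Perm.mem_alternatingGroup, Equiv.Perm.mem_alternatingGroup]
  rcases Int.units_eq_one_or (Equiv.Perm.sign x) with h | h <;>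
    rcases Int.units_eq_one_or (Equiv.Perm.sign y) with h' | h' <;> simp [h, h']

set_option maxRecDepth 100000 in
theorem mem_V4_or_pow_three_eq_one : ∀ x ∈ A4, x ∈ V4 ∨ x ^ 3 = 1 := by decide

set_option maxRecDepth 100000 in
-- The inverse is needed because `A₄` splits the eight 3-cycles into two classes, interchanged by
-- inversion.
theorem threeCycles_conj : ∀ x : S4, x ^ 3 = 1 → x ≠ 1 → ∀ y : S4, y ^ 3 = 1 → y ≠ 1 →
    ∃ g ∈ A4, y = g * x * g⁻¹ ∨ y = g * x⁻¹ * g⁻¹ := by decide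

set_option maxRecDepth 100000 in
theorem V4_conj : ∀ x ∈ V4, ∀ y ∈ V4, x ≠ 1 → y ≠ 1 → ∃ g ∈ A4, y = g * x * g⁻¹ := by decide

set_option maxRecDepth 100000 in
-- This commutator puts a 3-cycle, and hence `A₄`, into every normal subgroup of `S₄` that contains
-- an odd permutation.
theorem exists_commutator_threeCycle : ∀ x : S4, x ∉ A4 → ∃ g : S4,
    (x * (g * x⁻¹ * g⁻¹)) ^ 3 = 1 ∧ (x * (g * x⁻¹ * g⁻¹)) ≠ 1 := by decide

/-- Every subgroup of `S₄` normalized by `A₄` that contains a 3-cycle contains `A₄`. -/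
theorem A4_le_of_threeCycle {N : Subgroup S4} (hN : ∀ g ∈ A4, ∀ n ∈ N, g * n * g⁻¹ ∈ N)
    {x : S4} (hx : x ∈ N) (h3 : x ^ 3 = 1) (h1 : x ≠ 1) : A4 ≤ N := by
  rw [A4, ← Equiv.Perm.closure_three_cycles_eq_alternating, Subgroup.closure_le]
  intro y hy
  have hy3 : y ^ 3 = 1 := by rw [← Equiv.Perm.IsThreeCycle.orderOf hy, pow_orderOf_eq_one]
  have hy1 : y ≠ 1 := by
    rintro rfl
    have := Equiv.Perm.IsThreeCycle.orderOf hy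
    simp at this
  obtain ⟨g, hg, rfl | rfl⟩ := threeCycles_conj x h3 h1 y hy3 hy1
  · exact hN g hg x hx
  · exact hN g hg _ (inv_mem hx)

/-- `A₄` permutes the three involutions of `V₄` transitively, and an element of `A₄` outside `V₄` is
a 3-cycle. Invariance is required only under `A₄`, so that the lemma serves both projections `A₄`
and `S₄`. -/
theorem eq_of_le_A4 {N : Subgroup S4} (hN : ∀ g ∈ A4, ∀ n ∈ N, g * n * g⁻¹ ∈ N) (hle : N ≤ A4) :
    N = ⊥ ∨ N = V4 ∨ N = A4 := by
  by_cases h : N ≤ V4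
  · by_cases hb : N = ⊥
    · exact Or.inl hb
    · refine Or.inr (Or.inl (le_antisymm h fun y hy => ?_))
      obtain ⟨x, hx, hx1⟩ := Subgroup.ne_bot_iff_exists_ne_one.1 hb |>.elim
        fun x hx => (⟨x.1, x.2, fun h => hx (Subtype.ext h)⟩ : ∃ x, x ∈ N ∧ x ≠ 1)
      by_cases hy1 : y = 1
      · exact hy1 ▸ one_mem _
      obtain ⟨g, hg, rfl⟩ := V4_conj x (h hx) y hy hx1 hy1
      exact hN g hg x hx
  · obtain ⟨x, hx, hxV⟩ := SetLike.not_le_iff_exists.1 h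
    refine Or.inr (Or.inr (le_antisymm hle ?_))
    refine A4_le_of_threeCycle hN hx ?_ fun h1 => hxV (h1 ▸ one_mem _)
    exact (mem_V4_or_pow_three_eq_one x (hle hx)).resolve_left hxV

theorem eq_top_of_A4_lt {N : Subgroup S4} (h : A4 ≤ N) {x : S4} (hx : x ∈ N) (hx' : x ∉ A4) :
    N = ⊤ := by
  rw [eq_top_iff]
  intro y _
  by_cases hy : y ∈ A4
  · exact h hy
  have : y * x⁻¹ ∈ A4 := by
    rw [Equiv.Perm.mem_alternatingGroup] at *
    rw [map_mul, map_inv, (Int.units_eq_one_or _).resolve_left hy,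
      (Int.units_eq_one_or _).resolve_left hx']
    rfl
  simpa using mul_mem (h this) hx

theorem eq_of_normal {N : Subgroup S4} (hN : ∀ g, ∀ n ∈ N, g * n * g⁻¹ ∈ N) :
    N = ⊥ ∨ N = V4 ∨ N = A4 ∨ N = ⊤ := by
  by_cases hle : N ≤ A4
  · rcases eq_of_le_A4 (fun g _ => hN g) hle with h | h | h <;> simp [h]
  · obtain ⟨x, hx, hxA⟩ := SetLike.not_le_iff_exists.1 hle
    obtain ⟨g, h3, h1⟩ := exists_commutator_threeCycle x hxA
    refine Or.inr (Or.inr (Or.inr (eq_top_of_A4_lt ?_ hx hxA)))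
    exact A4_le_of_threeCycle (fun g _ => hN g) (mul_mem hx (hN g _ (inv_mem hx))) h3 h1

theorem eq_A4_of_card {G : Subgroup S4} (h : Nat.card G = 12) : G = A4 := by
  apply Equiv.Perm.eq_alternatingGroup_of_index_eq_two
  have := G.index_mul_card
  rw [h, card_S4] at this
  omega

theorem eq_top_of_card {G : Subgroup S4} (h : Nat.card G = 24) : G = ⊤ :=
  Subgroup.eq_top_of_card_eq G (h.trans card_S4.symm)

open scoped Pointwise in
-- Subgroups of order 8 are Sylow 2-subgroups of `S₄`, hence conjugate.
theorem exists_conjBy_eq_D4 {G : Subgroup S4} (h : Nat.card G = 8) : ∃ t, conjBy t G = D4 := by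
  have : Fact (Nat.Prime 2) := ⟨Nat.prime_two⟩
  have h24 : 2 ^ (Nat.card S4).factorization 2 = 8 := by
    rw [card_S4, show 24 = 2 ^ 3 * 3 by norm_num,
      Nat.factorization_mul (by norm_num) (by norm_num), Nat.factorization_pow]
    have h3 : (3 : ℕ).factorization 2 = 0 :=
      Nat.factorization_eq_zero_of_not_dvd (by norm_num)
    simp [h3, Nat.prime_two.factorization_self]
  let P := Sylow.ofCard (p := 2) G (h.trans h24.symm)
  let Q := Sylow.ofCard (p := 2) D4 (card_D4.trans h24.symm)
  obtain ⟨t, ht⟩ := MulAction.exists_smul_eq S4 Q P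
  refine ⟨t, ?_⟩
  have ht' : MulAut.conj t • D4 = G := by
    have := congrArg (fun S : Sylow 2 S4 => (S : Subgroup S4)) ht
    exact this
  ext g
  rw [mem_conjBy, ← ht', Subgroup.mem_pointwise_smul_iff_inv_smul_mem]
  simp [mul_assoc]

set_option maxRecDepth 100000 in
theorem fixes_or_mem_V4_or_fourCycle : ∀ x : S4, (∃ i, x i = i) ∨ x ∈ V4 ∨
    ∃ t : S4, x = t * fourCycle * t⁻¹ := by decide

/-- Up to conjugation the transitive subgroups of `S₄` are `S₄`, `A₄`, `D₄`, `C₄`, `V₄`. -/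
theorem exists_conjBy_of_transitive {G : Subgroup S4} (hG : ∀ i j, ∃ g ∈ G, g i = j) :
    ∃ t, conjBy t G = ⊤ ∨ conjBy t G = A4 ∨ conjBy t G = D4 ∨ conjBy t G = C4 ∨
      conjBy t G = V4 := by
  have : MulAction.IsPretransitive G (Fin 4) :=
    ⟨fun i j => by obtain ⟨g, hg, h⟩ := hG i j; exact ⟨⟨g, hg⟩, h⟩⟩
  have hst (i : Fin 4) : 4 * Nat.card (MulAction.stabilizer G i) = Nat.card G := by
    rw [← (MulAction.stabilizer G i).index_mul_card, MulAction.index_stabilizer_of_transitive]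
    simp
  have hdvd : Nat.card G ∣ 24 := card_S4 ▸ Subgroup.card_subgroup_dvd_card G
  -- By transitivity the order is `4 m` with `m` the order of a stabilizer, and it divides 24, so
  -- `m` divides 6.
  have hcases : Nat.card G = 24 ∨ Nat.card G = 12 ∨ Nat.card G = 8 ∨ Nat.card G = 4 := by
    have hm := hst 0
    generalize Nat.card (MulAction.stabilizer G (0 : Fin 4)) = m at hm
    rw [← hm] at hdvd ⊢
    have : m ∣ 6 := by
      rw [show 24 = 4 * 6 by norm_num] at hdvd
      exact Nat.dvd_of_mul_dvd_mul_left (by norm_num) hdvd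
    have hm6 := Nat.le_of_dvd (by norm_num) this
    interval_cases m <;> revert this <;> decide
  rcases hcases with h | h | h | h
  · exact ⟨1, Or.inl (eq_top_of_card ((card_conjBy _ _).trans h))⟩
  · exact ⟨1, Or.inr (Or.inl (eq_A4_of_card ((card_conjBy _ _).trans h)))⟩
  · obtain ⟨t, ht⟩ := exists_conjBy_eq_D4 h
    exact ⟨t, by simp [ht]⟩
  -- A transitive group of order 4 acts freely. An element outside `V₄` without fixed points is a
  -- 4-cycle, which then generates the group.
  · have hfix : ∀ g ∈ G, ∀ i, g i = i → g = 1 := by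
      intro g hg i hi
      have h1 : Nat.card (MulAction.stabilizer G i) = 1 := by have := hst i; omega
      have := (Subgroup.card_eq_one.1 h1) ▸ (show (⟨g, hg⟩ : G) ∈ MulAction.stabilizer G i from hi)
      exact congrArg Subtype.val (Subgroup.mem_bot.1 this)
    by_cases hV : G ≤ V4
    · have : G = V4 := Subgroup.eq_of_le_of_card_ge hV (by rw [h, card_V4])
      exact ⟨1, by rw [this, conjBy_of_normal]; simp⟩
    · obtain ⟨x, hx, hxV⟩ := SetLike.not_le_iff_exists.1 hV
      rcases fixes_or_mem_V4_or_fourCycle x with ⟨i, hi⟩ | hx' | ⟨t, rfl⟩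
      · exact absurd (hfix x hx i hi ▸ one_mem _) hxV
      · exact absurd hx' hxV
      · refine ⟨t, Or.inr (Or.inr (Or.inr (Or.inl (Eq.symm ?_))))⟩
        refine Subgroup.eq_of_le_of_card_ge ?_ (by rw [card_conjBy, h, card_C4])
        rw [Subgroup.zpowers_le]
        exact hx

/-! ### Subgroups of a product of two groups -/

section Goursat

variable {G G₂ : Type*} [Group G] [Group G₂]

/-- The elements `σ` with `(σ, 1) ∈ H`. -/
abbrev leftPart (H : Subgroup (G × G₂)) : Subgroup G := H.comap (MonoidHom.inl G G₂)

/-- The elements `τ` with `(1, τ) ∈ H`. -/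
abbrev rightPart (H : Subgroup (G × G₂)) : Subgroup G₂ := H.comap (MonoidHom.inr G G₂)

variable {H : Subgroup (G × G₂)}

theorem mem_leftPart {σ : G} : σ ∈ leftPart H ↔ (σ, 1) ∈ H := Iff.rfl

theorem mem_rightPart {τ : G₂} : τ ∈ rightPart H ↔ (1, τ) ∈ H := Iff.rfl

theorem mem_map_fst {σ : G} : σ ∈ H.map (MonoidHom.fst G G₂) ↔ ∃ τ, (σ, τ) ∈ H := by
  simp [Subgroup.mem_map]

theorem mem_map_snd {τ : G₂} : τ ∈ H.map (MonoidHom.snd G G₂) ↔ ∃ σ, (σ, τ) ∈ H := by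
  simp [Subgroup.mem_map]

/-- This is the Goursat correspondence: `H` induces an isomorphism between the quotients of its
projections by the left and the right part. -/
theorem mem_leftPart_iff_mem_rightPart {σ : G} {τ : G₂} (h : (σ, τ) ∈ H) :
    σ ∈ leftPart H ↔ τ ∈ rightPart H := by
  constructor <;> intro hs
  · simpa [mem_rightPart] using mul_mem (inv_mem (mem_leftPart.1 hs)) h
  · simpa [mem_leftPart] using mul_mem h (inv_mem (mem_rightPart.1 hs))

theorem leftPart_le : leftPart H ≤ H.map (MonoidHom.fst G G₂) :=
  fun _ h => mem_map_fst.2 ⟨1, h⟩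

theorem rightPart_le : rightPart H ≤ H.map (MonoidHom.snd G G₂) :=
  fun _ h => mem_map_snd.2 ⟨1, h⟩

theorem leftPart_conj {g : G} (hg : g ∈ H.map (MonoidHom.fst G G₂)) {n : G}
    (hn : n ∈ leftPart H) : g * n * g⁻¹ ∈ leftPart H := by
  obtain ⟨y, hy⟩ := mem_map_fst.1 hg
  simpa [mem_leftPart] using mul_mem (mul_mem hy hn) (inv_mem hy)

theorem rightPart_conj {g : G₂} (hg : g ∈ H.map (MonoidHom.snd G G₂)) {n : G₂}
    (hn : n ∈ rightPart H) : g * n * g⁻¹ ∈ rightPart H := by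
  obtain ⟨y, hy⟩ := mem_map_snd.1 hg
  simpa [mem_rightPart] using mul_mem (mul_mem hy hn) (inv_mem hy)

/-- The left part is the kernel of the second projection restricted to `H`. -/
theorem card_eq_leftPart_mul :
    Nat.card H = Nat.card (leftPart H) * Nat.card (H.map (MonoidHom.snd G G₂)) := by
  let f := (MonoidHom.snd G G₂).comp H.subtype
  have hr : f.range = H.map (MonoidHom.snd G G₂) := by
    rw [MonoidHom.range_comp, Subgroup.range_subtype]
  have hk : Nat.card f.ker = Nat.card (leftPart H) := by
    refine Nat.card_congr ⟨fun x => ⟨x.1.1.1, ?_⟩, fun x => ⟨⟨(x.1, 1), x.2⟩, rfl⟩, ?_, ?_⟩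
    · have h1 : x.1.1.2 = 1 := x.2
      rw [mem_leftPart, ← h1]
      exact x.1.2
    · rintro ⟨⟨⟨a, b⟩, hab⟩, hx⟩
      have h1 : b = 1 := hx
      subst h1
      rfl
    · intro x
      rfl
  rw [← hr, ← hk, ← Subgroup.index_ker f, mul_comm, f.ker.index_mul_card]

theorem card_eq_rightPart_mul :
    Nat.card H = Nat.card (rightPart H) * Nat.card (H.map (MonoidHom.fst G G₂)) := by
  let f := (MonoidHom.fst G G₂).comp H.subtype
  have hr : f.range = H.map (MonoidHom.fst G G₂) := by
    rw [MonoidHom.range_comp, Subgroup.range_subtype]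
  have hk : Nat.card f.ker = Nat.card (rightPart H) := by
    refine Nat.card_congr ⟨fun x => ⟨x.1.1.2, ?_⟩, fun x => ⟨⟨(1, x.1), x.2⟩, rfl⟩, ?_, ?_⟩
    · have h1 : x.1.1.1 = 1 := x.2
      rw [mem_rightPart, ← h1]
      exact x.1.2
    · rintro ⟨⟨⟨a, b⟩, hab⟩, hx⟩
      have h1 : a = 1 := hx
      subst h1
      rfl
    · intro x
      rfl
  rw [← hr, ← hk, ← Subgroup.index_ker f, mul_comm, f.ker.index_mul_card]

theorem eq_prod_of_leftPart (h : H.map (MonoidHom.fst G G₂) ≤ leftPart H) :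
    H = (H.map (MonoidHom.fst G G₂)).prod (H.map (MonoidHom.snd G G₂)) := by
  ext ⟨σ, τ⟩
  rw [Subgroup.mem_prod]
  constructor
  · exact fun hs => ⟨mem_map_fst.2 ⟨τ, hs⟩, mem_map_snd.2 ⟨σ, hs⟩⟩
  · rintro ⟨hσ, hτ⟩
    obtain ⟨σ', hmem⟩ := mem_map_snd.1 hτ
    have h1 : (σ * σ'⁻¹, 1) ∈ H := h (mul_mem hσ (inv_mem (mem_map_fst.2 ⟨τ, hmem⟩)))
    simpa using mul_mem h1 hmem

/-- A subgroup that contains the diagonal copy of its first projection is determined by that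
projection and its right part. -/
theorem mem_iff_of_diagonal {H : Subgroup (G × G)}
    (hd : ∀ g ∈ H.map (MonoidHom.fst G G), (g, g) ∈ H) {σ τ : G} :
    (σ, τ) ∈ H ↔ σ ∈ H.map (MonoidHom.fst G G) ∧ σ⁻¹ * τ ∈ rightPart H := by
  constructor
  · intro h
    have hσ : σ ∈ H.map (MonoidHom.fst G G) := mem_map_fst.2 ⟨τ, h⟩
    exact ⟨hσ, by simpa [mem_rightPart] using mul_mem (inv_mem (hd σ hσ)) h⟩
  · rintro ⟨h1, h2⟩
    simpa using mul_mem (hd σ h1) h2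

end Goursat

/-- A subgroup generated by two subgroups `N` and `Q` which intersect trivially, `Q` normalizing
`N`, is their semidirect product. -/
theorem nonempty_mulEquiv_conjSemidirect {G : Type*} [Group G] [Finite G] {N Q H : Subgroup G}
    (h : Q ≤ Subgroup.normalizer (N : Set G)) (hN : N ≤ H) (hQ : Q ≤ H)
    (hdisj : ∀ x ∈ N, x ∈ Q → x = 1) (hcard : Nat.card N * Nat.card Q = Nat.card H) :
    Nonempty (H ≃* ConjSemidirect N Q h) := by
  let φ : ConjSemidirect N Q h →* G := SemidirectProduct.monoidHomSubgroup h
  have hφ : ∀ x, φ x = x.left.1 * x.right.1 := fun x => rfl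
  have hmem : ∀ x, φ x ∈ H := fun x => by
    rw [hφ]; exact mul_mem (hN x.left.2) (hQ x.right.2)
  let ψ : ConjSemidirect N Q h →* H := φ.codRestrict H hmem
  have : Finite (ConjSemidirect N Q h) := Finite.of_equiv _ SemidirectProduct.equivProd.symm
  have hinj : Function.Injective ψ := by
    rw [injective_iff_map_eq_one]
    intro x hx
    have h1 : x.left.1 * x.right.1 = 1 := congrArg Subtype.val hx
    have h2 : x.left.1 = 1 := by
      refine hdisj _ x.left.2 ?_
      rw [eq_inv_of_mul_eq_one_left h1]
      exact inv_mem x.right.2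
    rw [h2, one_mul] at h1
    ext
    · exact h2
    · exact h1
  have hbij : Function.Bijective ψ := by
    rw [Nat.bijective_iff_injective_and_card]
    exact ⟨hinj, by rw [SemidirectProduct.card, hcard]⟩
  exact ⟨(MulEquiv.ofBijective ψ hbij).symm⟩

/-- Reduces questions about a finite cyclic group to finitely many exponents; `n` need not be the
exact order of `g`. -/
theorem mem_zpowers_iff_of_pow {G : Type*} [Group G] {g x : G} {n : ℕ} (hn : 0 < n)
    (hg : g ^ n = 1) (hx : x ∈ Subgroup.zpowers g) : ∃ k < n, x = g ^ k := by
  obtain ⟨k, rfl⟩ := hx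
  refine ⟨(k % n).toNat, ?_, ?_⟩
  · have := Int.emod_lt_of_pos k (show (0 : ℤ) < n by exact_mod_cast hn)
    have := Int.emod_nonneg k (show (n : ℤ) ≠ 0 by exact_mod_cast hn.ne')
    omega
  · have h0 := Int.emod_nonneg k (show (n : ℤ) ≠ 0 by exact_mod_cast hn.ne')
    change g ^ k = _
    rw [← zpow_natCast, Int.toNat_of_nonneg h0]
    conv_lhs => rw [← Int.emod_add_mul_ediv k n, zpow_add, zpow_mul, zpow_natCast, hg, one_zpow,
      mul_one]

/-! ### Rows fitting a subgroup of `S₄ × S₄` -/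

theorem QuarticType.Is.congr {G G₂ : Type*} [Group G] [Group G₂] {q : QuarticType}
    (h : q.Is G) (e : G ≃* G₂) : q.Is G₂ := by
  cases q <;> exact h.map e.symm.trans

theorem TableRow.HasProductGroup.congr {G G₂ : Type*} [Group G] [Group G₂] {r : TableRow}
    (h : r.HasProductGroup G) (e : G ≃* G₂) : r.HasProductGroup G₂ := by
  cases r <;> exact h.map e.symm.trans

/-- The degree of the intersection of the splitting fields. -/
def TableRow.degree : TableRow → ℕ
  | row01 | row05 | row06 | row14 | row17 | row18 | row19 | row10 | row12 => 1
  | row02 | row07 | row08 | row09 | row11 | row13 => 2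
  | row15 => 3
  | row03 => 6
  | row04 => 24
  | row16 => 12

/-- `m` is the multiset of the orbit lengths of the action `(σ, τ) • π = τ π σ⁻¹` of `H` on `S₄`;
the orbits are the fibres of `κ`. -/
def HasOrbitType (H : Subgroup (S4 × S4)) (m : Multiset ℕ) : Prop :=
  ∃ κ : S4 → ℕ, (∀ π π', κ π = κ π' ↔ ∃ h ∈ H, h.2 * π * h.1⁻¹ = π') ∧
    (Finset.univ.image κ).val.map (fun k => (Finset.univ.filter fun π => κ π = k).card) = m

/-- The row `r` describes the subgroup `H` of `S₄ × S₄`. -/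
structure Fits (H : Subgroup (S4 × S4)) (r : TableRow) : Prop where
  first : r.first.Is (H.map (MonoidHom.fst S4 S4))
  second : r.second.Is (H.map (MonoidHom.snd S4 S4))
  group : r.HasProductGroup H
  -- Since the product of the two Galois group orders is `[L L' : M] [L ∩ L' : M]`, this records the
  -- degree of the intersection in terms of `H` alone.
  degree : r.degree * Nat.card H =
    Nat.card (H.map (MonoidHom.fst S4 S4)) * Nat.card (H.map (MonoidHom.snd S4 S4))
  orbits : HasOrbitType H r.decType

/-- The subgroup of the `(σ, τ)` with `(σ, t τ t⁻¹) ∈ H`. -/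
abbrev relabel (t : S4) (H : Subgroup (S4 × S4)) : Subgroup (S4 × S4) :=
  H.comap ((MulEquiv.refl S4).prodCongr (MulAut.conj t)).toMonoidHom

theorem mem_relabel {t : S4} {H : Subgroup (S4 × S4)} {σ τ : S4} :
    (σ, τ) ∈ relabel t H ↔ (σ, t * τ * t⁻¹) ∈ H := Iff.rfl

theorem map_fst_relabel (t : S4) (H : Subgroup (S4 × S4)) :
    (relabel t H).map (MonoidHom.fst S4 S4) = H.map (MonoidHom.fst S4 S4) := by
  ext σ
  simp only [mem_map_fst, mem_relabel]
  constructor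
  · rintro ⟨τ, h⟩
    exact ⟨_, h⟩
  · rintro ⟨τ, h⟩
    exact ⟨t⁻¹ * τ * t, by simpa [mul_assoc] using h⟩

theorem map_snd_relabel (t : S4) (H : Subgroup (S4 × S4)) :
    (relabel t H).map (MonoidHom.snd S4 S4) = conjBy t (H.map (MonoidHom.snd S4 S4)) := by
  ext τ
  rw [mem_conjBy]
  simp only [mem_map_snd, mem_relabel]

theorem rightPart_relabel (t : S4) (H : Subgroup (S4 × S4)) :
    rightPart (relabel t H) = conjBy t (rightPart H) := rfl

theorem leftPart_relabel (t : S4) (H : Subgroup (S4 × S4)) :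
    leftPart (relabel t H) = leftPart H := by
  ext σ
  rw [mem_leftPart, mem_relabel, mul_one, mul_inv_cancel, mem_leftPart]

/-- The isomorphism of a group with its preimage under an automorphism. -/
noncomputable def comapEquiv {G : Type*} [Group G] (e : G ≃* G) (H : Subgroup G) :
    H.comap e.toMonoidHom ≃* H where
  toFun x := ⟨e x.1, x.2⟩
  invFun x := ⟨e.symm x.1, by simp [Subgroup.mem_comap, x.2]⟩
  left_inv x := Subtype.ext (e.symm_apply_apply _)
  right_inv x := Subtype.ext (e.apply_symm_apply _)
  map_mul' x y := Subtype.ext (map_mul e _ _)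

/-- Renumbering the second set of roots applies an automorphism of `S₄ × S₄` to `H`, and left
multiplication by `t⁻¹` carries the orbits of `H` to those of `relabel t H`. -/
theorem Fits.of_relabel {t : S4} {H : Subgroup (S4 × S4)} {r : TableRow}
    (h : Fits (relabel t H) r) : Fits H r where
  first := map_fst_relabel t H ▸ h.first
  second := by
    have := h.second
    rw [map_snd_relabel] at this
    exact this.congr (comapEquiv _ _)
  group := h.group.congr (comapEquiv _ _)
  degree := by
    have := h.degree
    rw [map_fst_relabel, map_snd_relabel, card_conjBy,
      Nat.card_congr (comapEquiv ((MulEquiv.refl S4).prodCongr (MulAut.conj t)) H).toEquiv] at this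
    exact this
  orbits := by
    obtain ⟨κ, hκ, hm⟩ := h.orbits
    refine ⟨fun π => κ (t⁻¹ * π), fun π π' => ?_, ?_⟩
    · rw [hκ]
      constructor
      · rintro ⟨⟨σ, τ⟩, hστ, hh⟩
        refine ⟨_, mem_relabel.1 hστ, ?_⟩
        rw [← mul_right_inj t⁻¹, ← hh]
        simp [mul_assoc]
      · rintro ⟨⟨σ, τ⟩, hστ, rfl⟩
        refine ⟨(σ, t⁻¹ * τ * t), mem_relabel.2 ?_, ?_⟩
        · simpa [mul_assoc] using hστ
        · simp [mul_assoc]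
    · rw [← hm]
      have him : Finset.univ.image (fun π => κ (t⁻¹ * π)) = Finset.univ.image κ := by
        ext k
        simp only [Finset.mem_image, Finset.mem_univ, true_and]
        exact ⟨fun ⟨π, h⟩ => ⟨_, h⟩, fun ⟨π, h⟩ => ⟨t * π, by simpa using h⟩⟩
      rw [him]
      refine Multiset.map_congr rfl fun k _ => ?_
      refine Finset.card_bij (fun π _ => t⁻¹ * π) ?_ ?_ ?_
      · simp
      · simp
      · intro π hπ
        exact ⟨t * π, by simpa using hπ, by simp⟩

/-! ### Orbit types -/

theorem sign_mem_A4 (x : S4) : x ∈ A4 ↔ Equiv.Perm.sign x = 1 := Equiv.Perm.mem_alternatingGroup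

/-- An even permutation carries any permutation to any other one of the same sign. -/
theorem exists_orbit_of_sign {H : Subgroup (S4 × S4)} (hA : A4 ≤ leftPart H) {π π' : S4}
    (h : Equiv.Perm.sign π = Equiv.Perm.sign π') : ∃ h ∈ H, h.2 * π * h.1⁻¹ = π' := by
  refine ⟨(π'⁻¹ * π, 1), hA ?_, by simp⟩
  rw [sign_mem_A4, map_mul, map_inv, h, inv_mul_cancel]

/-- The elements `(σ, 1)` with `σ` even fuse all permutations of the same sign; since signs agree on
`H`, the sign of `τ π σ⁻¹` is that of `π`. -/
theorem hasOrbitType_of_sign_eq {H : Subgroup (S4 × S4)} (hA : A4 ≤ leftPart H)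
    (h : ∀ σ τ, (σ, τ) ∈ H → (σ ∈ A4 ↔ τ ∈ A4)) : HasOrbitType H {12, 12} := by
  refine ⟨fun π => if π ∈ A4 then 0 else 1, fun π π' => ?_, by decide⟩
  constructor
  · intro hπ
    refine exists_orbit_of_sign hA (mem_A4_iff_mem_A4.1 ?_)
    by_cases h1 : π ∈ A4 <;> by_cases h2 : π' ∈ A4 <;> simp [h1, h2] at hπ ⊢
  · rintro ⟨⟨σ, τ⟩, hστ, rfl⟩
    have h1 := mem_A4_iff_mem_A4.1 (h σ τ hστ)
    have h2 : (τ * π * σ⁻¹ ∈ A4) ↔ π ∈ A4 := by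
      rw [mem_A4_iff_mem_A4, map_mul, map_mul, map_inv, h1, mul_comm, inv_mul_cancel_left]
    simp [h2]

/-- A pair with different signs carries one sign class into the other, so the two merge. -/
theorem hasOrbitType_of_sign_ne {H : Subgroup (S4 × S4)} (hA : A4 ≤ leftPart H) {σ τ : S4}
    (h : (σ, τ) ∈ H) (hne : ¬ (σ ∈ A4 ↔ τ ∈ A4)) : HasOrbitType H {24} := by
  refine ⟨fun _ => 0, fun π π' => iff_of_true rfl ?_, by decide⟩
  by_cases hs : Equiv.Perm.sign π = Equiv.Perm.sign π'
  · exact exists_orbit_of_sign hA hs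
  · have hs' : Equiv.Perm.sign (τ * π * σ⁻¹) = Equiv.Perm.sign π' := by
      rw [mem_A4_iff_mem_A4] at hne
      rw [map_mul, map_mul, map_inv]
      revert hs hne
      generalize Equiv.Perm.sign σ = a
      generalize Equiv.Perm.sign τ = b
      generalize Equiv.Perm.sign π = c
      generalize Equiv.Perm.sign π' = d
      revert a b c d
      decide
    obtain ⟨⟨σ', τ'⟩, h1, h2⟩ := exists_orbit_of_sign hA hs'
    refine ⟨_, mul_mem h1 h, ?_⟩
    rw [← h2]
    simp [mul_assoc]

/-- The group of the `g` such that `κ` is invariant under conjugation by `g`. -/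
def invarianceGroup (κ : S4 → ℕ) : Subgroup S4 where
  carrier := {g | ∀ π, κ (g * π * g⁻¹) = κ π}
  one_mem' := by simp
  mul_mem' {a b} ha hb π := by
    rw [← hb π, ← ha (b * π * b⁻¹)]
    simp [mul_assoc]
  inv_mem' {a} ha π := by
    rw [← ha (a⁻¹ * π * a⁻¹⁻¹)]
    simp [mul_assoc]

/-- Writing `τ = σ n` gives `τ π σ⁻¹ = σ (n π) σ⁻¹`: the orbits are the classes under left
multiplication by `N` and conjugation by `G`. The function `κ` is an invariant, and `ρ` supplies a
representative for each of its values, which shows that it is a complete one. -/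
theorem hasOrbitType_of_diagonal {H : Subgroup (S4 × S4)} {G N : Subgroup S4}
    (hH : ∀ σ τ, (σ, τ) ∈ H ↔ σ ∈ G ∧ σ⁻¹ * τ ∈ N) (κ : S4 → ℕ) (ρ : ℕ → S4)
    (hG : G ≤ invarianceGroup κ) (hN : ∀ v ∈ N, ∀ π, κ (v * π) = κ π)
    (ht : ∀ π, ∃ v ∈ N, ∃ g ∈ G, g * (v * π) * g⁻¹ = ρ (κ π)) {m : Multiset ℕ}
    (hm : (Finset.univ.image κ).val.map
      (fun k => (Finset.univ.filter fun π => κ π = k).card) = m) : HasOrbitType H m := by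
  have hρ : ∀ π, ∃ h ∈ H, h.2 * π * h.1⁻¹ = ρ (κ π) := fun π => by
    obtain ⟨v, hv, g, hg, h⟩ := ht π
    exact ⟨(g, g * v), (hH _ _).2 ⟨hg, by simpa using hv⟩, by simpa [mul_assoc] using h⟩
  refine ⟨κ, fun π π' => ⟨fun h => ?_, ?_⟩, hm⟩
  · obtain ⟨x, hx, h1⟩ := hρ π
    obtain ⟨y, hy, h2⟩ := hρ π'
    refine ⟨y⁻¹ * x, mul_mem (inv_mem hy) hx, ?_⟩
    rw [← h, ← h1] at h2
    simp only [Prod.snd_mul, Prod.fst_mul, Prod.snd_inv, Prod.fst_inv, mul_inv_rev, inv_inv]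
    calc y.2⁻¹ * x.2 * π * (x.1⁻¹ * y.1) = y.2⁻¹ * (x.2 * π * x.1⁻¹) * y.1 := by group
      _ = π' := by rw [← h2]; group
  · rintro ⟨⟨σ, τ⟩, hστ, rfl⟩
    obtain ⟨h1, h2⟩ := (hH σ τ).1 hστ
    rw [show τ * π * σ⁻¹ = σ * ((σ⁻¹ * τ) * π) * σ⁻¹ by simp [mul_assoc], hG h1, hN _ h2]

section

/-! ### The isomorphism types of the transitive groups -/

/-- The embedding of the dihedral group of order 8 as the symmetries of a square. -/
def dihedralFun : DihedralGroup 4 → S4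
  | .r i => fourCycle ^ i.val
  | .sr i => reflection * fourCycle ^ i.val

theorem dihedralFun_mul (x y : DihedralGroup 4) :
    dihedralFun (x * y) = dihedralFun x * dihedralFun y := by
  rcases x with i | i <;> rcases y with j | j <;> revert i j <;> decide

theorem is_D4 : QuarticType.D4.Is D4 := by
  let F : DihedralGroup 4 →* S4 := MonoidHom.mk' dihedralFun dihedralFun_mul
  have hmem : ∀ x, F x ∈ D4 := by
    rintro (i | i) <;> revert i <;> decide
  have hinj : Function.Injective (F.codRestrict D4 hmem) := by
    rw [injective_iff_map_eq_one]
    intro x hx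
    have h : dihedralFun x = 1 := congrArg Subtype.val hx
    rw [DihedralGroup.one_def]
    clear hx
    rcases x with i | i <;> revert i <;> decide
  have hbij : Function.Bijective (F.codRestrict D4 hmem) := by
    rw [Nat.bijective_iff_injective_and_card]
    exact ⟨hinj, by rw [card_D4, DihedralGroup.nat_card]⟩
  exact ⟨(MulEquiv.ofBijective _ hbij).symm⟩

theorem is_S4 : QuarticType.S4.Is (⊤ : Subgroup S4) := ⟨Subgroup.topEquiv⟩

theorem is_A4 : QuarticType.A4.Is A4 := ⟨MulEquiv.refl _⟩

theorem is_C4 : QuarticType.C4.Is C4 := ⟨MulEquiv.refl _⟩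

theorem is_V4 : QuarticType.V4.Is V4 := ⟨MulEquiv.refl _⟩

variable {H : Subgroup (S4 × S4)}

/-! ### Linearly disjoint splitting fields -/

theorem fits_of_prod {r : TableRow} (hN : H.map (MonoidHom.fst S4 S4) ≤ leftPart H)
    (h1 : r.first.Is (H.map (MonoidHom.fst S4 S4)))
    (h2 : r.second.Is (H.map (MonoidHom.snd S4 S4))) (hd : r.degree = 1)
    (hg : r.HasProductGroup (H.map (MonoidHom.fst S4 S4) × H.map (MonoidHom.snd S4 S4)))
    (ho : HasOrbitType H r.decType) : Fits H r where
  first := h1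
  second := h2
  group := hg.congr
    ((MulEquiv.subgroupCongr (eq_prod_of_leftPart hN)).trans (Subgroup.prodEquiv _ _)).symm
  degree := by
    rw [hd, one_mul, card_eq_leftPart_mul, le_antisymm leftPart_le hN]
  orbits := ho

theorem exists_fits_of_prod_top (hN : H.map (MonoidHom.fst S4 S4) ≤ leftPart H)
    (h1 : H.map (MonoidHom.fst S4 S4) = ⊤)
    (h2 : H.map (MonoidHom.snd S4 S4) = ⊤ ∨ H.map (MonoidHom.snd S4 S4) = A4 ∨
      H.map (MonoidHom.snd S4 S4) = D4 ∨ H.map (MonoidHom.snd S4 S4) = C4 ∨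
      H.map (MonoidHom.snd S4 S4) = V4) : ∃ r, Fits H r := by
  have hA : A4 ≤ leftPart H := le_trans (by rw [h1]; exact le_top) hN
  have ht : (transposition, 1) ∈ H := hN (by rw [h1]; trivial)
  have ho : HasOrbitType H {24} := hasOrbitType_of_sign_ne hA ht (by decide)
  have t1 : QuarticType.S4.Is (H.map (MonoidHom.fst S4 S4)) := h1 ▸ is_S4
  rcases h2 with h2 | h2 | h2 | h2 | h2
  · have t2 : QuarticType.S4.Is (H.map (MonoidHom.snd S4 S4)) := h2 ▸ is_S4
    exact ⟨.row01, fits_of_prod hN t1 t2 rfl (t1.elim fun e => t2.map (e.prodCongr ·)) ho⟩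
  · have t2 : QuarticType.A4.Is (H.map (MonoidHom.snd S4 S4)) := h2 ▸ is_A4
    exact ⟨.row05, fits_of_prod hN t1 t2 rfl (t1.elim fun e => t2.map (e.prodCongr ·)) ho⟩
  · have t2 : QuarticType.D4.Is (H.map (MonoidHom.snd S4 S4)) := h2 ▸ is_D4
    exact ⟨.row06, fits_of_prod hN t1 t2 rfl (t1.elim fun e => t2.map (e.prodCongr ·)) ho⟩
  · have t2 : QuarticType.C4.Is (H.map (MonoidHom.snd S4 S4)) := h2 ▸ is_C4
    exact ⟨.row10, fits_of_prod hN t1 t2 rfl (t1.elim fun e => t2.map (e.prodCongr ·)) ho⟩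
  · have t2 : QuarticType.V4.Is (H.map (MonoidHom.snd S4 S4)) := h2 ▸ is_V4
    exact ⟨.row12, fits_of_prod hN t1 t2 rfl (t1.elim fun e => t2.map (e.prodCongr ·)) ho⟩

theorem exists_fits_of_prod_A4 (hN : H.map (MonoidHom.fst S4 S4) ≤ leftPart H)
    (h1 : H.map (MonoidHom.fst S4 S4) = A4)
    (h2 : H.map (MonoidHom.snd S4 S4) = A4 ∨
      H.map (MonoidHom.snd S4 S4) = D4 ∨ H.map (MonoidHom.snd S4 S4) = C4 ∨
      H.map (MonoidHom.snd S4 S4) = V4) : ∃ r, Fits H r := by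
  have hA : A4 ≤ leftPart H := le_trans (by rw [h1]) hN
  have hmem {τ : S4} (hτ : τ ∈ H.map (MonoidHom.snd S4 S4)) : (1, τ) ∈ H := by
    rw [eq_prod_of_leftPart hN]
    exact ⟨one_mem _, hτ⟩
  -- The first component is always even here, so the number of orbits depends only on whether the
  -- second projection contains an odd permutation.
  have heven (h : H.map (MonoidHom.snd S4 S4) ≤ A4) : HasOrbitType H {12, 12} :=
    hasOrbitType_of_sign_eq hA fun σ τ hστ =>
      iff_of_true (h1 ▸ mem_map_fst.2 ⟨τ, hστ⟩) (h (mem_map_snd.2 ⟨σ, hστ⟩))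
  have t1 : QuarticType.A4.Is (H.map (MonoidHom.fst S4 S4)) := h1 ▸ is_A4
  rcases h2 with h2 | h2 | h2 | h2
  · have t2 : QuarticType.A4.Is (H.map (MonoidHom.snd S4 S4)) := h2 ▸ is_A4
    exact ⟨.row14, fits_of_prod hN t1 t2 rfl (t1.elim fun e => t2.map (e.prodCongr ·))
      (heven h2.le)⟩
  · have t2 : QuarticType.D4.Is (H.map (MonoidHom.snd S4 S4)) := h2 ▸ is_D4
    have hm : (1, reflection) ∈ H := hmem (h2 ▸ by decide)
    exact ⟨.row17, fits_of_prod hN t1 t2 rfl (t1.elim fun e => t2.map (e.prodCongr ·))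
      (hasOrbitType_of_sign_ne hA hm (by decide))⟩
  · have t2 : QuarticType.C4.Is (H.map (MonoidHom.snd S4 S4)) := h2 ▸ is_C4
    have hm : (1, fourCycle) ∈ H := hmem (h2 ▸ by decide)
    exact ⟨.row18, fits_of_prod hN t1 t2 rfl (t1.elim fun e => t2.map (e.prodCongr ·))
      (hasOrbitType_of_sign_ne hA hm (by decide))⟩
  · have t2 : QuarticType.V4.Is (H.map (MonoidHom.snd S4 S4)) := h2 ▸ is_V4
    exact ⟨.row19, fits_of_prod hN t1 t2 rfl (t1.elim fun e => t2.map (e.prodCongr ·))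
      (heven (h2.trans_le V4_le_A4))⟩

/-! ### Splitting fields meeting in a quadratic extension -/

/-- Modulo `A₄` only the sign of `σ` matters, and the Goursat correspondence matches it with
membership of `τ` in the right part. -/
theorem mem_iff_of_leftPart_eq_A4 (hN : leftPart H = A4) {σ τ : S4} :
    (σ, τ) ∈ H ↔ τ ∈ H.map (MonoidHom.snd S4 S4) ∧ (σ ∈ A4 ↔ τ ∈ rightPart H) := by
  constructor
  · intro h
    exact ⟨mem_map_snd.2 ⟨σ, h⟩, hN ▸ mem_leftPart_iff_mem_rightPart h⟩
  · rintro ⟨h1, h2⟩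
    obtain ⟨σ', h'⟩ := mem_map_snd.1 h1
    have h3 : σ' ∈ A4 ↔ τ ∈ rightPart H := hN ▸ mem_leftPart_iff_mem_rightPart h'
    have h4 := mem_A4_iff_mem_A4.1 (h2.trans h3.symm)
    have h5 : σ * σ'⁻¹ ∈ leftPart H := by
      rw [hN, sign_mem_A4, map_mul, map_inv, h4, mul_inv_cancel]
    simpa using mul_mem (mem_leftPart.1 h5) h'

theorem card_prod_subgroup {G G₂ : Type*} [Group G] [Group G₂] (N : Subgroup G)
    (N' : Subgroup G₂) : Nat.card (N.prod N') = Nat.card N * Nat.card N' := by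
  rw [Nat.card_congr (Subgroup.prodEquiv N N').toEquiv, Nat.card_prod]

theorem card_zpowers_two {G : Type*} [Group G] {g : G} (h1 : g ≠ 1) (h2 : g ^ 2 = 1) :
    Nat.card (Subgroup.zpowers g) = 2 := by
  rw [Nat.card_zpowers, orderOf_eq_prime_iff.2 ⟨h2, h1⟩]

theorem card_of_leftPart_eq_A4 (hN : leftPart H = A4) :
    Nat.card H = 12 * Nat.card (H.map (MonoidHom.snd S4 S4)) := by
  rw [card_eq_leftPart_mul, hN, card_A4]

/-- If the product of an odd permutation and an involution lies in `H`, then `H` is a semidirect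
product of `A₄ × N` by a group of order 2. -/
theorem nonempty_mulEquiv_of_involution {N : Subgroup S4} {H : Subgroup (S4 × S4)} {t r : S4}
    (h : Subgroup.zpowers (t, r) ≤ Subgroup.normalizer ((A4.prod N : Subgroup (S4 × S4)) : Set _))
    (hN : A4.prod N ≤ H) (hm : (t, r) ∈ H) (ht : t ∉ A4) (ht2 : t ^ 2 = 1) (hr2 : r ^ 2 = 1)
    (hc : Nat.card H = 24 * Nat.card N) :
    Nonempty (H ≃* ConjSemidirect (A4.prod N) (Subgroup.zpowers (t, r)) h) := by
  have h2 : (t, r) ^ 2 = 1 := Prod.ext ht2 hr2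
  have h1 : (t, r) ≠ 1 := fun h => ht ((show t = 1 from congrArg Prod.fst h) ▸ one_mem _)
  refine nonempty_mulEquiv_conjSemidirect h hN ((Subgroup.zpowers_le).2 hm) ?_ ?_
  · intro x hx hx'
    obtain ⟨k, hk, rfl⟩ := mem_zpowers_iff_of_pow (by norm_num) h2 hx'
    interval_cases k
    · rfl
    · rw [pow_one] at hx
      exact absurd hx.1 ht
  · rw [card_zpowers_two h1 h2, card_prod_subgroup, card_A4, hc]
    ring

theorem fits_of_leftPart_eq_A4 {r : TableRow} (hN : leftPart H = A4)
    (h1 : H.map (MonoidHom.fst S4 S4) = ⊤) (hr : r.first = .S4)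
    (h2 : r.second.Is (H.map (MonoidHom.snd S4 S4)))
    (hd : r.degree = 2) (hg : r.HasProductGroup H)
    (ho : HasOrbitType H r.decType) : Fits H r where
  first := by rw [hr, h1]; exact is_S4
  second := h2
  group := hg
  degree := by
    rw [hd, card_of_leftPart_eq_A4 hN, h1, Subgroup.card_top, card_S4]
    ring
  orbits := ho

theorem card_rightPart_of_leftPart_eq_A4 (hN : leftPart H = A4)
    (h1 : H.map (MonoidHom.fst S4 S4) = ⊤) :
    2 * Nat.card (rightPart H) = Nat.card (H.map (MonoidHom.snd S4 S4)) := by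
  have e1 := card_of_leftPart_eq_A4 hN
  have e2 := card_eq_rightPart_mul (H := H)
  rw [h1, Subgroup.card_top, card_S4] at e2
  omega

theorem A4_prod_le (hN : leftPart H = A4) {N : Subgroup S4} (h : N ≤ rightPart H) :
    A4.prod N ≤ H := by
  rintro ⟨σ, τ⟩ ⟨hσ, hτ⟩
  have h1 : (σ, 1) ∈ H := mem_leftPart.1 (hN ▸ hσ)
  simpa using mul_mem h1 (mem_rightPart.1 (h hτ))

theorem fits_row02 (hN : leftPart H = A4) (h1 : H.map (MonoidHom.fst S4 S4) = ⊤)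
    (h2 : H.map (MonoidHom.snd S4 S4) = ⊤) (hr : rightPart H = A4) : Fits H .row02 := by
  have hmem {σ τ : S4} : (σ, τ) ∈ H ↔ (σ ∈ A4 ↔ τ ∈ A4) := by
    rw [mem_iff_of_leftPart_eq_A4 hN, h2, hr]
    simp
  refine fits_of_leftPart_eq_A4 hN h1 rfl (h2 ▸ is_S4) rfl ?_
    (hasOrbitType_of_sign_eq hN.ge fun σ τ => hmem.1)
  exact nonempty_mulEquiv_of_involution _ (A4_prod_le hN hr.ge) (hmem.2 Iff.rfl) (by decide)
    (by decide) (by decide)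
    (by rw [card_of_leftPart_eq_A4 hN, h2, Subgroup.card_top, card_S4, card_A4])

theorem fits_row07 (hN : leftPart H = A4) (h1 : H.map (MonoidHom.fst S4 S4) = ⊤)
    (h2 : H.map (MonoidHom.snd S4 S4) = D4) (hr : rightPart H = C4) : Fits H .row07 := by
  have hmem {σ τ : S4} : (σ, τ) ∈ H ↔ τ ∈ D4 ∧ (σ ∈ A4 ↔ τ ∈ C4) := by
    rw [mem_iff_of_leftPart_eq_A4 hN, h2, hr]
  have hm : (1, fourCycle) ∈ H := hmem.2 (by decide)
  refine fits_of_leftPart_eq_A4 hN h1 rfl (h2 ▸ is_D4) rfl ?_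
    (hasOrbitType_of_sign_ne hN.ge hm (by decide))
  exact nonempty_mulEquiv_of_involution _ (A4_prod_le hN hr.ge) (hmem.2 (by decide)) (by decide)
    (by decide) (by decide)
    (by rw [card_of_leftPart_eq_A4 hN, h2, card_D4, card_C4])

/-- The even elements of `D₄` are exactly those of `V₄`, so the signs agree on `H`. The right parts
of rows 7 and 8 contain odd permutations instead. -/
theorem fits_row09 (hN : leftPart H = A4) (h1 : H.map (MonoidHom.fst S4 S4) = ⊤)
    (h2 : H.map (MonoidHom.snd S4 S4) = D4) (hr : rightPart H = V4) : Fits H .row09 := by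
  have hmem {σ τ : S4} : (σ, τ) ∈ H ↔ τ ∈ D4 ∧ (σ ∈ A4 ↔ τ ∈ V4) := by
    rw [mem_iff_of_leftPart_eq_A4 hN, h2, hr]
  have hD : ∀ τ ∈ D4, τ ∈ V4 ↔ τ ∈ A4 := by decide
  refine fits_of_leftPart_eq_A4 hN h1 rfl (h2 ▸ is_D4) rfl ?_
    (hasOrbitType_of_sign_eq hN.ge fun σ τ h => (hmem.1 h).2.trans (hD τ (hmem.1 h).1))
  exact nonempty_mulEquiv_of_involution _ (A4_prod_le hN hr.ge) (hmem.2 (by decide)) (by decide)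
    (by decide) (by decide)
    (by rw [card_of_leftPart_eq_A4 hN, h2, card_D4, card_V4])

/-- On `D₄` this is an automorphism which fixes the rotations and exchanges the two kinds of
reflections. -/
def twist (g : S4) : S4 := if g ∈ C4 then g else g * fourCycle

theorem twist_mul : ∀ g ∈ D4, ∀ h ∈ D4, twist (g * h) = twist g * twist h := by decide

theorem twist_eq_one : ∀ g ∈ D4, twist g = 1 → g = 1 := by decide

/-- The right part is the other Klein four-subgroup of `D₄`, which contains transpositions; this
merges the orbits. As an abstract group `H` is still that of row 9: applying `twist` to the second
component carries this right part to `V₄`. -/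
theorem fits_row08 (hN : leftPart H = A4) (h1 : H.map (MonoidHom.fst S4 S4) = ⊤)
    (h2 : H.map (MonoidHom.snd S4 S4) = D4)
    (hr : ∀ τ, τ ∈ rightPart H ↔ τ = 1 ∨ τ = halfTurn ∨ τ = reflection ∨
      τ = halfTurn * reflection) : Fits H .row08 := by
  have hmem {σ τ : S4} : (σ, τ) ∈ H ↔ τ ∈ D4 ∧ (σ ∈ A4 ↔ (τ = 1 ∨ τ = halfTurn ∨
      τ = reflection ∨ τ = halfTurn * reflection)) := by
    rw [mem_iff_of_leftPart_eq_A4 hN, h2, hr]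
  have hm : (1, reflection) ∈ H := hmem.2 (by decide)
  refine fits_of_leftPart_eq_A4 hN h1 rfl (h2 ▸ is_D4) rfl ?_
    (hasOrbitType_of_sign_ne hN.ge hm (by decide))
  have hD : ∀ x : H, x.1.2 ∈ D4 := fun x => (hmem.1 x.2).1
  let F : H →* S4 × S4 := MonoidHom.mk' (fun x => (x.1.1, twist x.1.2)) fun x y =>
    Prod.ext rfl (twist_mul _ (hD x) _ (hD y))
  have hF : Function.Injective F := by
    rw [injective_iff_map_eq_one]
    intro x hx
    have e1 : x.1.1 = 1 := congrArg Prod.fst hx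
    have e2 : twist x.1.2 = 1 := congrArg Prod.snd hx
    exact Subtype.ext (Prod.ext e1 (twist_eq_one _ (hD x) e2))
  have hrange {σ τ : S4} (τ' : S4) (h : τ' ∈ D4 ∧ (σ ∈ A4 ↔ (τ' = 1 ∨ τ' = halfTurn ∨
      τ' = reflection ∨ τ' = halfTurn * reflection))) (ht : twist τ' = τ) : (σ, τ) ∈ F.range :=
    ⟨⟨(σ, τ'), hmem.2 h⟩, Prod.ext rfl ht⟩
  have htw : ∀ v ∈ V4, ∃ τ, (τ ∈ D4 ∧ (τ = 1 ∨ τ = halfTurn ∨ τ = reflection ∨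
      τ = halfTurn * reflection)) ∧ twist τ = v := by decide
  have hcard : Nat.card F.range = 24 * Nat.card V4 := by
    rw [← Nat.card_congr (MonoidHom.ofInjective hF).toEquiv, card_of_leftPart_eq_A4 hN, h2,
      card_D4, card_V4]
  have key : (TableRow.row08).HasProductGroup F.range := by
    refine nonempty_mulEquiv_of_involution _ ?_ ?_ (by decide) (by decide) (by decide) hcard
    · rintro ⟨σ, v⟩ ⟨hσ, hv⟩
      obtain ⟨τ, ⟨h1, h2⟩, h3⟩ := htw v hv
      exact hrange τ ⟨h1, iff_of_true hσ h2⟩ h3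
    · have : ∃ τ, (τ ∈ D4 ∧ (transposition ∈ A4 ↔ (τ = 1 ∨ τ = halfTurn ∨ τ = reflection ∨
        τ = halfTurn * reflection))) ∧ twist τ = reflection := by decide
      obtain ⟨τ, h1, h2⟩ := this
      exact hrange τ h1 h2
  exact key.congr (MonoidHom.ofInjective hF).symm

theorem fits_row11 (hN : leftPart H = A4) (h1 : H.map (MonoidHom.fst S4 S4) = ⊤)
    (h2 : H.map (MonoidHom.snd S4 S4) = C4)
    (hr : ∀ τ, τ ∈ rightPart H ↔ τ = 1 ∨ τ = halfTurn) : Fits H .row11 := by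
  have hmem {σ τ : S4} : (σ, τ) ∈ H ↔ τ ∈ C4 ∧ (σ ∈ A4 ↔ (τ = 1 ∨ τ = halfTurn)) := by
    rw [mem_iff_of_leftPart_eq_A4 hN, h2, hr]
  have hC : ∀ τ ∈ C4, (τ = 1 ∨ τ = halfTurn) ↔ τ ∈ A4 := by decide
  have h4 : (transposition, fourCycle) ^ 4 = 1 := by decide
  have ho : orderOf (transposition, fourCycle) = 4 :=
    orderOf_eq_prime_pow (p := 2) (n := 1) (by decide) h4
  refine fits_of_leftPart_eq_A4 hN h1 rfl (h2 ▸ is_C4) rfl ?_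
    (hasOrbitType_of_sign_eq hN.ge fun σ τ h => (hmem.1 h).2.trans (hC τ (hmem.1 h).1))
  -- An element of `H` with odd first component has a second component of order 4, so no involution
  -- gives a complement. The complement is cyclic of order 4, and the normal factor is `A₄ × 1`.
  refine nonempty_mulEquiv_conjSemidirect _ (A4_prod_le hN bot_le)
    ((Subgroup.zpowers_le).2 (hmem.2 (by decide))) ?_ ?_
  · rintro x hx hx'
    obtain ⟨k, hk, rfl⟩ := mem_zpowers_iff_of_pow (by norm_num) h4 hx'
    have h5 : fourCycle ^ k = 1 := hx.2
    revert h5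
    interval_cases k <;> decide
  · rw [Nat.card_zpowers, ho, card_prod_subgroup, card_A4, Subgroup.card_bot,
      card_of_leftPart_eq_A4 hN, h2, card_C4]

/-- The homomorphism from `S₄` onto a group of order 2 in `V₄`. -/
def signV4 (σ : S4) : S4 := if σ ∈ A4 then 1 else Equiv.swap 0 1 * Equiv.swap 2 3

/-- The subgroup generated by `halfTurn`, as a power function. -/
def halfTurnPow (e : Multiplicative (ZMod 2)) : S4 := if e = 1 then 1 else halfTurn

/-- The map `signV4` goes into a complement of the right part in `V₄`, so its graph is a copy of
`S₄` in `H`. That copy commutes with the group of order 2 generated by `(1, halfTurn)`. -/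
theorem fits_row13 (hN : leftPart H = A4) (h1 : H.map (MonoidHom.fst S4 S4) = ⊤)
    (h2 : H.map (MonoidHom.snd S4 S4) = V4)
    (hr : ∀ τ, τ ∈ rightPart H ↔ τ = 1 ∨ τ = halfTurn) : Fits H .row13 := by
  have hmem {σ τ : S4} : (σ, τ) ∈ H ↔ τ ∈ V4 ∧ (σ ∈ A4 ↔ (τ = 1 ∨ τ = halfTurn)) := by
    rw [mem_iff_of_leftPart_eq_A4 hN, h2, hr]
  have hm : (transposition, Equiv.swap 0 1 * Equiv.swap 2 3) ∈ H := hmem.2 (by decide)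
  refine fits_of_leftPart_eq_A4 hN h1 rfl (h2 ▸ is_V4) rfl ?_
    (hasOrbitType_of_sign_ne hN.ge hm (by decide))
  have hs : ∀ σ σ', signV4 (σ * σ') = signV4 σ * signV4 σ' := by decide
  have hp : ∀ e e', halfTurnPow (e * e') = halfTurnPow e * halfTurnPow e' := by decide
  have hc : ∀ σ e, signV4 σ * halfTurnPow e = halfTurnPow e * signV4 σ := by decide
  let F : S4 × Multiplicative (ZMod 2) →* S4 × S4 :=
    MonoidHom.mk' (fun x => (x.1, signV4 x.1 * halfTurnPow x.2)) fun x y => Prod.ext rfl (by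
      change signV4 (x.1 * y.1) * halfTurnPow (x.2 * y.2) =
        signV4 x.1 * halfTurnPow x.2 * (signV4 y.1 * halfTurnPow y.2)
      rw [hs, hp, mul_assoc, mul_assoc, ← mul_assoc (signV4 y.1), ← mul_assoc (halfTurnPow x.2),
        hc])
  have hmF : ∀ x, F x ∈ H := fun x => by
    have : ∀ σ e, signV4 σ * halfTurnPow e ∈ V4 ∧
        (σ ∈ A4 ↔ (signV4 σ * halfTurnPow e = 1 ∨ signV4 σ * halfTurnPow e = halfTurn)) := by
      decide
    exact hmem.2 (this x.1 x.2)
  have hinj : Function.Injective (F.codRestrict H hmF) := by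
    rw [injective_iff_map_eq_one]
    rintro ⟨σ, e⟩ hx
    have hx' : F (σ, e) = 1 := congrArg Subtype.val hx
    have hσ : σ = 1 := congrArg Prod.fst hx'
    subst hσ
    have he : signV4 1 * halfTurnPow e = 1 := congrArg Prod.snd hx'
    have : ∀ e, signV4 1 * halfTurnPow e = 1 → e = 1 := by decide
    rw [this e he]
    rfl
  have hbij : Function.Bijective (F.codRestrict H hmF) := by
    rw [Nat.bijective_iff_injective_and_card]
    refine ⟨hinj, ?_⟩
    rw [Nat.card_prod, card_S4, card_of_leftPart_eq_A4 hN, h2, card_V4,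
      Nat.card_congr Multiplicative.toAdd, Nat.card_zmod]
  exact ⟨(MulEquiv.ofBijective _ hbij).symm⟩

end

/-! ### Subgroups of index 2 in the second projection -/

section

variable {H : Subgroup (S4 × S4)}

theorem mem_iff_of_card_two {G : Type*} [Group G] [Finite G] {N : Subgroup G} {z : G}
    (hN : Nat.card N = 2) (hz : z ∈ N) (hz1 : z ≠ 1) (τ : G) : τ ∈ N ↔ τ = 1 ∨ τ = z := by
  have hz2 : z ^ 2 = 1 := by
    have := pow_card_eq_one' (x := (⟨z, hz⟩ : N))
    rw [hN] at this
    exact congrArg Subtype.val this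
  have h : Subgroup.zpowers z = N :=
    Subgroup.eq_of_le_of_card_ge ((Subgroup.zpowers_le).2 hz) (by rw [hN, card_zpowers_two hz1 hz2])
  constructor
  · intro hτ
    obtain ⟨k, hk, rfl⟩ := mem_zpowers_iff_of_pow (by norm_num) hz2 (h ▸ hτ)
    interval_cases k <;> simp
  · rintro (rfl | rfl)
    exacts [one_mem _, hz]

/-- The square of any `σ` is even. This forces `halfTurn`, the square of `fourCycle`, into the right
part when the second projection is `D₄` or `C₄`. -/
theorem sq_mem_rightPart (hN : leftPart H = A4) {τ : S4}
    (h : τ ∈ H.map (MonoidHom.snd S4 S4)) : τ ^ 2 ∈ rightPart H := by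
  obtain ⟨σ, hσ⟩ := mem_map_snd.1 h
  have h2 : (σ ^ 2, τ ^ 2) ∈ H := pow_mem hσ 2
  rw [← mem_leftPart_iff_mem_rightPart h2, hN, sign_mem_A4, map_pow]
  exact Int.units_sq _

/-- The right part has index 2 in the second projection. `S₄` and `C₄` have one such subgroup and
`A₄` has none. The three in `D₄` give rows 7, 8 and 9, and the three in `V₄` become one after
renumbering. -/
theorem exists_fits_of_leftPart_eq_A4 (hN : leftPart H = A4)
    (h1 : H.map (MonoidHom.fst S4 S4) = ⊤)
    (h2 : H.map (MonoidHom.snd S4 S4) = ⊤ ∨ H.map (MonoidHom.snd S4 S4) = A4 ∨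
      H.map (MonoidHom.snd S4 S4) = D4 ∨ H.map (MonoidHom.snd S4 S4) = C4 ∨
      H.map (MonoidHom.snd S4 S4) = V4) : ∃ r, Fits H r := by
  have hcard := card_rightPart_of_leftPart_eq_A4 hN h1
  have hle := rightPart_le (H := H)
  rcases h2 with h2 | h2 | h2 | h2 | h2
  · rw [h2, Subgroup.card_top, card_S4] at hcard
    exact ⟨_, fits_row02 hN h1 h2 (eq_A4_of_card (by omega))⟩
  · exfalso
    have hn : ∀ g ∈ A4, ∀ n ∈ rightPart H, g * n * g⁻¹ ∈ rightPart H := fun g hg n hn =>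
      rightPart_conj (h2.symm ▸ hg) hn
    rw [h2] at hle
    rw [h2, card_A4] at hcard
    rcases eq_of_le_A4 hn hle with h | h | h <;> rw [h] at hcard
    · rw [Subgroup.card_bot] at hcard; omega
    · rw [card_V4] at hcard; omega
    · rw [card_A4] at hcard; omega
  · have hcyc : fourCycle ∈ H.map (MonoidHom.snd S4 S4) := h2 ▸ by decide
    have hhalf : halfTurn ∈ rightPart H := by
      have := sq_mem_rightPart hN hcyc
      rwa [show fourCycle ^ 2 = halfTurn by decide] at this
    rw [h2] at hle
    rw [h2, card_D4] at hcard
    -- The right part has order 4, and any element other than `1` and `halfTurn` tells which of the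
    -- three subgroups of index 2 it is.
    have hx : ∃ x ∈ rightPart H, x ≠ 1 ∧ x ≠ halfTurn := by
      by_contra! hx
      have hz2 : halfTurn ^ 2 = 1 := by decide
      have : rightPart H ≤ Subgroup.zpowers halfTurn := fun x hxm => by
        by_cases hx1 : x = 1
        · exact hx1 ▸ one_mem _
        · exact hx x hxm hx1 ▸ Subgroup.mem_zpowers _
      have := Subgroup.card_le_of_le this
      rw [card_zpowers_two (by decide) hz2] at this
      omega
    obtain ⟨x, hx, hx1, hxz⟩ := hx
    have hmem : ∀ y, (y = 1 ∨ y = halfTurn ∨ y = x ∨ y = halfTurn * x ∨ y = halfTurn * x ^ 2 ∨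
        y = x⁻¹) → y ∈ rightPart H := by
      rintro y (rfl | rfl | rfl | rfl | rfl | rfl)
      exacts [one_mem _, hhalf, hx, mul_mem hhalf hx, mul_mem hhalf (pow_mem hx 2), inv_mem hx]
    have hxc : x = fourCycle ∨ x = fourCycle⁻¹ ∨ x ∈ V4 ∨ x = reflection ∨
        x = halfTurn * reflection := by
      have : ∀ x ∈ D4, x ≠ 1 → x ≠ halfTurn → x = fourCycle ∨ x = fourCycle⁻¹ ∨ x ∈ V4 ∨
        x = reflection ∨ x = halfTurn * reflection := by decide
      exact this x (hle hx) hx1 hxz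
    have hC (h : fourCycle ∈ rightPart H) : ∃ r, Fits H r := by
      refine ⟨_, fits_row07 hN h1 h2 (Eq.symm ?_)⟩
      exact Subgroup.eq_of_le_of_card_ge ((Subgroup.zpowers_le).2 h) (by rw [card_C4]; omega)
    have hR (h : reflection ∈ rightPart H) : ∃ r, Fits H r := by
      let K : Subgroup S4 := Subgroup.centralizer {reflection}
      have hK : ∀ τ, τ ∈ K ↔ τ = 1 ∨ τ = halfTurn ∨ τ = reflection ∨
          τ = halfTurn * reflection := by
        have : ∀ τ : S4, τ * reflection = reflection * τ ↔ τ = 1 ∨ τ = halfTurn ∨ τ = reflection ∨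
          τ = halfTurn * reflection := by decide
        intro τ
        rw [← this, Subgroup.mem_centralizer_singleton_iff]
      have : DecidablePred (· ∈ K) := fun τ => decidable_of_iff _ (hK τ).symm
      have hKc : Nat.card K = 4 := by
        rw [card_subgroup_eq, Finset.filter_congr fun τ _ => hK τ]
        decide
      have hKR : K = rightPart H := by
        refine Subgroup.eq_of_le_of_card_ge ?_ (by rw [hKc]; omega)
        intro τ hτ
        rcases (hK τ).1 hτ with rfl | rfl | rfl | rfl
        exacts [one_mem _, hhalf, h, mul_mem hhalf h]
      exact ⟨_, fits_row08 hN h1 h2 (hKR ▸ hK)⟩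
    rcases hxc with rfl | rfl | hx' | rfl | rfl
    · exact hC hx
    · exact hC (by simpa using inv_mem hx)
    · refine ⟨_, fits_row09 hN h1 h2 (Eq.symm ?_)⟩
      refine Subgroup.eq_of_le_of_card_ge (fun v hv => ?_) (by rw [card_V4]; omega)
      have : ∀ x ∈ V4, ∀ v ∈ V4, x ≠ 1 → x ≠ halfTurn → (v = 1 ∨ v = halfTurn ∨ v = x ∨
        v = halfTurn * x) := by decide
      refine hmem v ?_
      rcases this x hx' v hv hx1 hxz with h | h | h | h <;> simp [h]
    · exact hR hx
    · refine hR ?_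
      have := mul_mem hhalf hx
      rwa [← mul_assoc, show halfTurn * halfTurn = 1 by decide, one_mul] at this
  · have hcyc : fourCycle ∈ H.map (MonoidHom.snd S4 S4) := h2 ▸ by decide
    have hhalf : halfTurn ∈ rightPart H := by
      have := sq_mem_rightPart hN hcyc
      rwa [show fourCycle ^ 2 = halfTurn by decide] at this
    rw [h2, card_C4] at hcard
    exact ⟨_, fits_row11 hN h1 h2 (mem_iff_of_card_two (by omega) hhalf (by decide))⟩
  · rw [h2, card_V4] at hcard
    rw [h2] at hle
    have hb : rightPart H ≠ ⊥ := by
      intro h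
      rw [h, Subgroup.card_bot] at hcard
      omega
    obtain ⟨⟨x, hx⟩, hx1⟩ := Subgroup.ne_bot_iff_exists_ne_one.1 hb
    obtain ⟨t, -, ht⟩ := V4_conj halfTurn (by decide) x (hle hx) (by decide)
      fun h => hx1 (Subtype.ext h)
    refine ⟨.row13, Fits.of_relabel (t := t) (fits_row13 ?_ ?_ ?_ ?_)⟩
    · rw [leftPart_relabel, hN]
    · rw [map_fst_relabel, h1]
    · rw [map_snd_relabel, h2, conjBy_of_normal]
    · refine mem_iff_of_card_two ?_ ?_ (by decide)
      · rw [rightPart_relabel, card_conjBy]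
        omega
      · rw [rightPart_relabel, mem_conjBy, ← ht]
        exact hx

/-! ### Splitting fields meeting in a field that contains a cubic resolvent field -/

set_option maxRecDepth 100000 in
-- In `S₄ / V₄ ≅ S₃`, any element of order 3 and any element of order 2 are simultaneously conjugate
-- to a fixed such pair: automorphisms of `S₃` are inner.
theorem exists_conj_mod_V4 : ∀ x y : S4, x ∉ V4 → x ^ 3 ∈ V4 → y ∉ V4 → y ^ 2 ∈ V4 → ∃ t : S4,
    x⁻¹ * (t * threeCycle * t⁻¹) ∈ V4 ∧ y⁻¹ * (t * transposition * t⁻¹) ∈ V4 := by decide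

set_option maxRecDepth 100000 in
set_option synthInstance.maxSize 2000 in
-- There are 8 · 3 = 24 such pairs and `S₄` acts freely on them by `eq_one_of_commute`, hence simply
-- transitively. So automorphisms of `A₄` are conjugations in `S₄`.
theorem exists_conj_A4 : ∀ x : S4, x ^ 3 = 1 → x ≠ 1 → ∀ y ∈ V4, y ≠ 1 → ∃ t : S4,
    t * threeCycle * t⁻¹ = x ∧ t * halfTurn * t⁻¹ = y := by decide

set_option maxRecDepth 100000 in
theorem eq_one_of_commute : ∀ z : S4, z * threeCycle = threeCycle * z →
    z * halfTurn = halfTurn * z → z = 1 := by decide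

theorem A4_le_of_V4_le {K : Subgroup S4} (hV : V4 ≤ K) (h3 : threeCycle ∈ K) : A4 ≤ K := by
  intro g hg
  have : ∀ g ∈ A4, g ∈ V4 ∨ threeCycle⁻¹ * g ∈ V4 ∨ threeCycle * g ∈ V4 := by decide
  rcases this g hg with h | h | h
  · exact hV h
  · simpa using mul_mem h3 (hV h)
  · simpa using mul_mem (inv_mem h3) (hV h)

theorem A4_le_of_generators {K : Subgroup S4} (h2 : halfTurn ∈ K) (h3 : threeCycle ∈ K) :
    A4 ≤ K := by
  refine A4_le_of_V4_le (fun v hv => ?_) h3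
  have : ∀ v ∈ V4, v = 1 ∨ v = halfTurn ∨ v = threeCycle * halfTurn * threeCycle⁻¹ ∨
    v = threeCycle⁻¹ * halfTurn * threeCycle := by decide
  rcases this v hv with rfl | rfl | rfl | rfl
  exacts [one_mem _, h2, mul_mem (mul_mem h3 h2) (inv_mem h3),
    mul_mem (mul_mem (inv_mem h3) h2) h3]

/-- The elements `g` with `(g, t g t⁻¹) ∈ H`. -/
abbrev diagonalPart (t : S4) (H : Subgroup (S4 × S4)) : Subgroup S4 :=
  (relabel t H).comap ((MonoidHom.id S4).prod (MonoidHom.id S4))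

theorem mem_diagonalPart {t g : S4} : g ∈ diagonalPart t H ↔ (g, t * g * t⁻¹) ∈ H := Iff.rfl

theorem A4_le_of_eq {G : Subgroup S4} (h : G = ⊤ ∨ G = A4) : A4 ≤ G := by
  rcases h with rfl | rfl
  exacts [le_top, le_rfl]

/-- Modulo `V₄ × V₄`, `H` is the graph of an isomorphism between subgroups of `S₃`, which is
conjugation by some `t`. As `V₄` lies in the diagonal part for every `t`, it suffices to match
generators modulo `V₄`. -/
theorem exists_diagonal_of_V4 (hl : leftPart H = V4) (hr : rightPart H = V4)
    (h1 : H.map (MonoidHom.fst S4 S4) = ⊤ ∨ H.map (MonoidHom.fst S4 S4) = A4) :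
    ∃ t, H.map (MonoidHom.fst S4 S4) ≤ diagonalPart t H := by
  have hiff {σ τ : S4} (h : (σ, τ) ∈ H) : σ ∈ V4 ↔ τ ∈ V4 := by
    rw [← hl, mem_leftPart_iff_mem_rightPart h, hr, hl]
  have hV (t : S4) : V4 ≤ diagonalPart t H := fun v hv => by
    have e1 : (v, 1) ∈ H := mem_leftPart.1 (hl ▸ hv)
    have e2 : (1, t * v * t⁻¹) ∈ H := mem_rightPart.1 (hr ▸ V4_normal.conj_mem v hv t)
    simpa only [mem_diagonalPart, Prod.mk_mul_mk, mul_one, one_mul] using mul_mem e1 e2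
  have hmod {g x t : S4} (h : (g, x) ∈ H) (ht : x⁻¹ * (t * g * t⁻¹) ∈ V4) :
      g ∈ diagonalPart t H := by
    have e2 : (1, x⁻¹ * (t * g * t⁻¹)) ∈ H := mem_rightPart.1 (hr ▸ ht)
    simpa only [mem_diagonalPart, Prod.mk_mul_mk, mul_one, mul_inv_cancel_left] using mul_mem h e2
  obtain ⟨x, hx⟩ := mem_map_fst.1 (A4_le_of_eq h1 (show threeCycle ∈ A4 by decide))
  have hx1 : x ∉ V4 := fun h => absurd ((hiff hx).2 h) (by decide)
  have hx3 : x ^ 3 ∈ V4 := (hiff (pow_mem hx 3)).1 (show threeCycle ^ 3 ∈ V4 by decide)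
  rcases h1 with h1 | h1
  · obtain ⟨y, hy⟩ := mem_map_fst.1 (show transposition ∈ H.map (MonoidHom.fst S4 S4) by
      rw [h1]; trivial)
    have hy1 : y ∉ V4 := fun h => absurd ((hiff hy).2 h) (by decide)
    have hy2 : y ^ 2 ∈ V4 := (hiff (pow_mem hy 2)).1 (show transposition ^ 2 ∈ V4 by decide)
    obtain ⟨t, ht, ht'⟩ := exists_conj_mod_V4 x y hx1 hx3 hy1 hy2
    refine ⟨t, ?_⟩
    rw [eq_top_of_A4_lt (A4_le_of_V4_le (hV t) (hmod hx ht)) (hmod hy ht') (by decide)]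
    exact le_top
  -- Only the 3-cycle has to be matched; the transposition fills the second slot.
  · obtain ⟨t, ht, -⟩ := exists_conj_mod_V4 x transposition hx1 hx3 (by decide) (by decide)
    exact ⟨t, h1.le.trans (A4_le_of_V4_le (hV t) (hmod hx ht))⟩

set_option maxRecDepth 10000 in
-- Here `H` is the graph of an isomorphism. Matching the images of the generators `threeCycle` and
-- `halfTurn` makes it conjugation by `t` on `A₄`, and the trivial centralizer of `A₄` in `S₄`
-- extends this to the whole projection.
theorem exists_diagonal_of_bot (hl : leftPart H = ⊥) (hr : rightPart H = ⊥)
    (h1 : H.map (MonoidHom.fst S4 S4) = ⊤ ∨ H.map (MonoidHom.fst S4 S4) = A4)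
    (h2 : H.map (MonoidHom.snd S4 S4) = H.map (MonoidHom.fst S4 S4)) :
    ∃ t, H.map (MonoidHom.fst S4 S4) ≤ diagonalPart t H := by
  have hiff {σ τ : S4} (h : (σ, τ) ∈ H) : σ = 1 ↔ τ = 1 := by
    rw [← Subgroup.mem_bot, ← hl, mem_leftPart_iff_mem_rightPart h, hr, Subgroup.mem_bot]
  have huniq {σ τ τ' : S4} (h : (σ, τ) ∈ H) (h' : (σ, τ') ∈ H) : τ = τ' := by
    have h3 := (hiff (mul_mem (inv_mem h) h')).1 (inv_mul_cancel σ)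
    exact inv_mul_eq_one.1 h3
  obtain ⟨x, hx⟩ := mem_map_fst.1 (A4_le_of_eq h1 (show threeCycle ∈ A4 by decide))
  have hx1 : x ≠ 1 := fun h => absurd ((hiff hx).2 h) (by decide)
  have hx3 : x ^ 3 = 1 := (hiff (pow_mem hx 3)).1 (show threeCycle ^ 3 = 1 by decide)
  -- The image of `halfTurn` must not be a transposition. For `S₄` it is the square of the image of
  -- a 4-cycle; for `A₄` it is an even permutation with square 1.
  obtain ⟨y, hy, hyV⟩ : ∃ y, (halfTurn, y) ∈ H ∧ y ∈ V4 := by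
    rcases h1 with h1 | h1
    · obtain ⟨y, hy⟩ := mem_map_fst.1 (show fourCycle ∈ H.map (MonoidHom.fst S4 S4) by
        rw [h1]; trivial)
      have hy4 : y ^ 4 = 1 := (hiff (pow_mem hy 4)).1 (show fourCycle ^ 4 = 1 by decide)
      have : ∀ y : S4, y ^ 4 = 1 → y ^ 2 ∈ V4 := by decide
      refine ⟨y ^ 2, ?_, this y hy4⟩
      have := pow_mem hy 2
      rwa [Prod.pow_mk, show fourCycle ^ 2 = halfTurn by decide] at this
    · obtain ⟨y, hy⟩ := mem_map_fst.1 (A4_le_of_eq (.inr h1) (show halfTurn ∈ A4 by decide))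
      have hy2 : y ^ 2 = 1 := (hiff (pow_mem hy 2)).1 (show halfTurn ^ 2 = 1 by decide)
      have hyA : y ∈ A4 := by rw [← h1, ← h2]; exact mem_map_snd.2 ⟨_, hy⟩
      have : ∀ y ∈ A4, y ^ 2 = 1 → y ∈ V4 := by decide
      exact ⟨y, hy, this y hyA hy2⟩
  have hy1 : y ≠ 1 := fun h => absurd ((hiff hy).2 h) (by decide)
  obtain ⟨t, rfl, rfl⟩ := exists_conj_A4 x hx3 hx1 y hyV hy1
  have hA : A4 ≤ diagonalPart t H := A4_le_of_generators hy hx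
  refine ⟨t, fun g hg => ?_⟩
  obtain ⟨u, hu⟩ := mem_map_fst.1 hg
  -- Conjugation by `u` and by `t g t⁻¹` agree on `A₄`, so their quotient, moved back by `t`,
  -- centralizes `A₄`.
  have hcomm : ∀ w ∈ A4, (t⁻¹ * u⁻¹ * t * g) * w = w * (t⁻¹ * u⁻¹ * t * g) := by
    intro w hw
    have e1 := mul_mem (mul_mem hu (mem_diagonalPart.1 (hA hw))) (inv_mem hu)
    have e2 := mem_diagonalPart.1 (hA (show g * w * g⁻¹ ∈ A4 from
      (alternatingGroup.normal).conj_mem w hw g))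
    have e3 : u * (t * w * t⁻¹) * u⁻¹ = t * (g * w * g⁻¹) * t⁻¹ := huniq e1 e2
    have e4 : w = t⁻¹ * u⁻¹ * (t * (g * w * g⁻¹) * t⁻¹) * u * t := by
      rw [← e3]
      group
    conv_rhs => rw [e4]
    group
  have hz := eq_one_of_commute _ (hcomm _ (by decide)) (hcomm _ (by decide))
  have hut : u = t * g * t⁻¹ := by
    have : u = u * t * (t⁻¹ * u⁻¹ * t * g) * t⁻¹ := by rw [hz]; group
    rw [this]
    group
  rw [mem_diagonalPart, ← hut]
  exact hu

end

/-! ### The rows containing a diagonal, and the full case distinction -/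

section

variable {H : Subgroup (S4 × S4)}

/-- The isomorphism type of a subgroup that is the graph of a homomorphism. -/
theorem nonempty_mulEquiv_map_fst {G G₂ : Type*} [Group G] [Group G₂] [Finite G] [Finite G₂]
    {H : Subgroup (G × G₂)} (hr : rightPart H = ⊥) :
    Nonempty (H ≃* H.map (MonoidHom.fst G G₂)) := by
  let f := (MonoidHom.fst G G₂).subgroupMap H
  have hbij : Function.Bijective f := by
    rw [Nat.bijective_iff_surjective_and_card]
    refine ⟨MonoidHom.subgroupMap_surjective _ _, ?_⟩
    rw [card_eq_rightPart_mul, hr, Subgroup.card_bot, one_mul]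
  exact ⟨MulEquiv.ofBijective f hbij⟩

theorem card_S3 : Nat.card S3 = 6 := by
  have h := S3.index_mul_card
  rw [MulAction.index_stabilizer_of_transitive, card_S4, Nat.card_eq_fintype_card,
    Fintype.card_fin] at h
  omega

/-- A function on `S₄` whose fibres are the orbits of `(V₄ × V₄) ⋊ S₃`. -/
def orbitV4S4 (π : S4) : ℕ := if π ∈ V4 then 0 else if π ∈ A4 then 1 else 2

/-- A function on `S₄` whose fibres are the orbits of `(V₄ × V₄) ⋊ C₃`. -/
def orbitV4A4 (π : S4) : ℕ :=
  if π ∈ V4 then 0 else if π ∈ A4 then (if threeCycle⁻¹ * π ∈ V4 then 1 else 2) else 3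

/-- A function on `S₄` whose fibres are the conjugacy classes. -/
def orbitS4 (π : S4) : ℕ :=
  if π ∈ A4 then (if π = 1 then 0 else if π ∈ V4 then 1 else 2) else if π ^ 2 = 1 then 3 else 4

/-- A function on `S₄` whose fibres are the classes under conjugation by `A₄`. -/
def orbitA4 (π : S4) : ℕ :=
  if π ∈ A4 then (if π = 1 then 0 else if π ∈ V4 then 1 else if threeCycle⁻¹ * π ∈ V4 then 2
    else 5) else if π ^ 2 = 1 then 3 else 4

/-- Representatives of the orbits of `(V₄ × V₄) ⋊ S₃`. -/
def repV4S4 : ℕ → S4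
  | 0 => 1
  | 1 => threeCycle
  | _ => transposition

/-- Representatives of the orbits of `(V₄ × V₄) ⋊ C₃`. -/
def repV4A4 : ℕ → S4
  | 0 => 1
  | 1 => threeCycle
  | 2 => threeCycle⁻¹
  | _ => transposition

/-- Representatives of the conjugacy classes of `S₄` and of its classes under `A₄`. -/
def repClass : ℕ → S4
  | 0 => 1
  | 1 => halfTurn
  | 2 => threeCycle
  | 3 => transposition
  | 4 => fourCycle
  | _ => threeCycle⁻¹

theorem A4_le_invarianceGroup {κ : S4 → ℕ}
    (h2 : ∀ π, κ (halfTurn * π * halfTurn⁻¹) = κ π)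
    (h3 : ∀ π, κ (threeCycle * π * threeCycle⁻¹) = κ π) : A4 ≤ invarianceGroup κ :=
  A4_le_of_generators (K := invarianceGroup κ) h2 h3

theorem top_le_invarianceGroup {κ : S4 → ℕ}
    (h2 : ∀ π, κ (halfTurn * π * halfTurn⁻¹) = κ π)
    (h3 : ∀ π, κ (threeCycle * π * threeCycle⁻¹) = κ π)
    (h1 : ∀ π, κ (transposition * π * transposition⁻¹) = κ π) : ⊤ ≤ invarianceGroup κ :=
  (eq_top_of_A4_lt (A4_le_of_generators (K := invarianceGroup κ) h2 h3) (x := transposition) h1 (by decide)).ge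

theorem mem_iff_of_diagonal_of_rightPart {G N : Subgroup S4}
    (h1 : H.map (MonoidHom.fst S4 S4) = G) (hr : rightPart H = N)
    (hd : ∀ g ∈ G, (g, g) ∈ H) (σ τ : S4) : (σ, τ) ∈ H ↔ σ ∈ G ∧ σ⁻¹ * τ ∈ N := by
  subst h1 hr
  exact mem_iff_of_diagonal hd

theorem V4_prod_le {G : Subgroup S4} (hG : V4 ≤ G)
    (hmem : ∀ σ τ, (σ, τ) ∈ H ↔ σ ∈ G ∧ σ⁻¹ * τ ∈ V4) : V4.prod V4 ≤ H := by
  rintro ⟨σ, τ⟩ ⟨hσ, hτ⟩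
  exact (hmem σ τ).2 ⟨hG hσ, mul_mem (inv_mem hσ) hτ⟩

set_option maxRecDepth 100000 in
-- The orbits are the preimages of the conjugacy classes of `S₄ / V₄ ≅ S₃`, of sizes 1, 2, 3 times
-- 4. The point stabilizer is a complement because `V₄` acts freely.
theorem fits_row03 (h1 : H.map (MonoidHom.fst S4 S4) = ⊤)
    (h2 : H.map (MonoidHom.snd S4 S4) = ⊤) (hr : rightPart H = V4) (hd : ∀ g, (g, g) ∈ H) :
    Fits H .row03 := by
  have hmem := mem_iff_of_diagonal_of_rightPart h1 hr fun g _ => hd g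
  have hc : Nat.card H = 96 := by
    rw [card_eq_rightPart_mul, hr, h1, Subgroup.card_top, card_S4, card_V4]
  refine ⟨h1 ▸ is_S4, h2 ▸ is_S4, ?_, ?_, ?_⟩
  · refine nonempty_mulEquiv_conjSemidirect _ (V4_prod_le le_top hmem) ?_ ?_ ?_
    · rintro _ ⟨s, -, rfl⟩
      exact hd s
    · rintro _ hx ⟨s, hs, rfl⟩
      have : ∀ s ∈ V4, s 3 = 3 → s = 1 := by decide
      have hs1 : s = 1 := this s hx.1 hs
      rw [hs1, map_one]
    · rw [Subgroup.card_map_of_injective fun a b h => congrArg Prod.fst h, card_S3,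
        card_prod_subgroup, card_V4, hc]
  · rw [hc, h1, h2, Subgroup.card_top, card_S4]
    rfl
  · refine hasOrbitType_of_diagonal hmem orbitV4S4 repV4S4
      (top_le_invarianceGroup (by decide) (by decide) (by decide)) (by decide) (fun π => ?_)
      (by decide)
    have : ∀ π, ∃ v ∈ V4, ∃ g, g * (v * π) * g⁻¹ = repV4S4 (orbitV4S4 π) := by decide
    obtain ⟨v, hv, g, hg⟩ := this π
    exact ⟨v, hv, g, trivial, hg⟩

set_option maxRecDepth 100000 in
-- The action of the diagonal is conjugation, so the orbits are the conjugacy classes of `S₄`.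
theorem fits_row04 (h1 : H.map (MonoidHom.fst S4 S4) = ⊤)
    (h2 : H.map (MonoidHom.snd S4 S4) = ⊤) (hr : rightPart H = ⊥) (hd : ∀ g, (g, g) ∈ H) :
    Fits H .row04 := by
  have hmem := mem_iff_of_diagonal_of_rightPart h1 hr fun g _ => hd g
  have hc : Nat.card H = 24 := by
    rw [card_eq_rightPart_mul, hr, h1, Subgroup.card_top, card_S4, Subgroup.card_bot]
  refine ⟨h1 ▸ is_S4, h2 ▸ is_S4, ?_, ?_, ?_⟩
  · have : QuarticType.S4.Is (H.map (MonoidHom.fst S4 S4)) := h1 ▸ is_S4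
    exact (nonempty_mulEquiv_map_fst hr).elim fun e => this.map e.trans
  · rw [hc, h1, h2, Subgroup.card_top, card_S4]
    rfl
  · refine hasOrbitType_of_diagonal hmem orbitS4 repClass
      (top_le_invarianceGroup (by decide) (by decide) (by decide)) (fun v hv π => ?_)
      (fun π => ?_) (by decide)
    · rw [Subgroup.mem_bot.1 hv, one_mul]
    · have : ∀ π, ∃ g, g * π * g⁻¹ = repClass (orbitS4 π) := by decide
      obtain ⟨g, hg⟩ := this π
      exact ⟨1, one_mem _, g, trivial, by simpa using hg⟩

set_option maxRecDepth 100000 in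
-- Modulo `V₄` the group `C₃` acts on `S₃` by conjugation: it fixes the three rotations and permutes
-- the three reflections cyclically.
theorem fits_row15 (h1 : H.map (MonoidHom.fst S4 S4) = A4)
    (h2 : H.map (MonoidHom.snd S4 S4) = A4) (hr : rightPart H = V4)
    (hd : ∀ g ∈ A4, (g, g) ∈ H) : Fits H .row15 := by
  have hmem := mem_iff_of_diagonal_of_rightPart h1 hr hd
  have hc : Nat.card H = 48 := by
    rw [card_eq_rightPart_mul, hr, h1, card_A4, card_V4]
  refine ⟨h1 ▸ is_A4, h2 ▸ is_A4, ?_, ?_, ?_⟩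
  · have h3 : (threeCycle, threeCycle) ^ 3 = 1 := by decide
    have ho : orderOf (threeCycle, threeCycle) = 3 :=
      orderOf_eq_prime_iff.2 ⟨h3, by decide⟩
    refine nonempty_mulEquiv_conjSemidirect _ (V4_prod_le V4_le_A4 hmem)
      ((Subgroup.zpowers_le).2 (hd _ (by decide))) ?_ ?_
    · intro x hx hx'
      obtain ⟨k, hk, rfl⟩ := mem_zpowers_iff_of_pow (by norm_num) h3 hx'
      have h5 : threeCycle ^ k ∈ V4 := hx.1
      revert h5
      interval_cases k <;> decide
    · rw [Nat.card_zpowers, ho, card_prod_subgroup, card_V4, hc]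
  · rw [hc, h1, h2, card_A4]
    rfl
  · exact hasOrbitType_of_diagonal hmem orbitV4A4 repV4A4
      (A4_le_invarianceGroup (by decide) (by decide)) (by decide) (by decide) (by decide)

set_option maxRecDepth 100000 in
-- Under conjugation by `A₄` only the class of 3-cycles of `S₄` splits, namely 8 into 4 and 4.
theorem fits_row16 (h1 : H.map (MonoidHom.fst S4 S4) = A4)
    (h2 : H.map (MonoidHom.snd S4 S4) = A4) (hr : rightPart H = ⊥)
    (hd : ∀ g ∈ A4, (g, g) ∈ H) : Fits H .row16 := by
  have hmem := mem_iff_of_diagonal_of_rightPart h1 hr hd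
  have hc : Nat.card H = 12 := by
    rw [card_eq_rightPart_mul, hr, h1, card_A4, Subgroup.card_bot]
  refine ⟨h1 ▸ is_A4, h2 ▸ is_A4, ?_, ?_, ?_⟩
  · have : QuarticType.A4.Is (H.map (MonoidHom.fst S4 S4)) := h1 ▸ is_A4
    exact (nonempty_mulEquiv_map_fst hr).elim fun e => this.map e.trans
  · rw [hc, h1, h2, card_A4]
    rfl
  · refine hasOrbitType_of_diagonal hmem orbitA4 repClass
      (A4_le_invarianceGroup (by decide) (by decide)) (fun v hv π => ?_) (fun π => ?_) (by decide)
    · rw [Subgroup.mem_bot.1 hv, one_mul]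
    · have : ∀ π, ∃ g ∈ A4, g * π * g⁻¹ = repClass (orbitA4 π) := by decide
      obtain ⟨g, hg, hconj⟩ := this π
      exact ⟨1, one_mem _, g, hg, by simpa using hconj⟩

/-- Two transitive subgroups of `S₄` of the types in the table, the first of them `S₄` or `A₄`:
every subgroup of their product with these projections is described by a row of the table. -/
theorem exists_fits_of_projections
    (h1 : H.map (MonoidHom.fst S4 S4) = ⊤ ∨ H.map (MonoidHom.fst S4 S4) = A4)
    (h2 : H.map (MonoidHom.snd S4 S4) = ⊤ ∨ H.map (MonoidHom.snd S4 S4) = A4 ∨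
      H.map (MonoidHom.snd S4 S4) = D4 ∨ H.map (MonoidHom.snd S4 S4) = C4 ∨
      H.map (MonoidHom.snd S4 S4) = V4)
    (hcard : Nat.card (H.map (MonoidHom.snd S4 S4)) ≤ Nat.card (H.map (MonoidHom.fst S4 S4))) :
    ∃ r, Fits H r := by
  have hc1 := card_eq_leftPart_mul (H := H)
  rw [card_eq_rightPart_mul] at hc1
  have hctop : Nat.card (⊤ : Subgroup S4) = 24 := by rw [Subgroup.card_top, card_S4]
  have hbot {N : Subgroup S4} (h : Nat.card N = 1) : N = ⊥ := Subgroup.card_eq_one.1 h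
  have hleft : leftPart H = ⊥ ∨ leftPart H = V4 ∨ leftPart H = A4 ∨ leftPart H = ⊤ := by
    rcases h1 with h1 | h1
    · exact eq_of_normal fun g n hn => leftPart_conj (h1 ▸ trivial) hn
    · rcases eq_of_le_A4 (fun g hg n hn => leftPart_conj (h1.symm ▸ hg) hn)
        (leftPart_le.trans h1.le) with h | h | h <;> simp [h]
  have hright (h : A4 ≤ H.map (MonoidHom.snd S4 S4)) : rightPart H = ⊥ ∨ rightPart H = V4 ∨
      rightPart H = A4 ∨ rightPart H = ⊤ := by
    by_cases h3 : rightPart H ≤ A4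
    · rcases eq_of_le_A4 (fun g hg n hn => rightPart_conj (h hg) hn) h3 with h | h | h <;> simp [h]
    · obtain ⟨x, hx, hx'⟩ := SetLike.not_le_iff_exists.1 h3
      have h4 := eq_top_of_A4_lt h (rightPart_le hx) hx'
      exact eq_of_normal fun g n hn => rightPart_conj (h4 ▸ trivial) hn
  have hpos : 0 < Nat.card (rightPart H) := Nat.card_pos
  by_cases hprod : H.map (MonoidHom.fst S4 S4) ≤ leftPart H
  · rcases h1 with h1 | h1
    · exact exists_fits_of_prod_top hprod h1 h2
    · refine exists_fits_of_prod_A4 hprod h1 (h2.resolve_left fun h => ?_)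
      rw [h, h1, hctop, card_A4] at hcard
      omega
  by_cases hl : leftPart H = A4
  · rcases h1 with h1 | h1
    · exact exists_fits_of_leftPart_eq_A4 hl h1 h2
    · exact absurd (by rw [hl, h1]) hprod
  have hlV : leftPart H = ⊥ ∨ leftPart H = V4 := by
    rcases hleft with h | h | h | h
    · exact .inl h
    · exact .inr h
    · exact absurd h hl
    · exact absurd (h ▸ le_top) hprod
  have hclt : Nat.card (leftPart H) = 1 ∨ Nat.card (leftPart H) = 4 := by
    rcases hlV with h | h
    · exact .inl (h ▸ Subgroup.card_bot)
    · exact .inr (h ▸ card_V4)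
  have hsnd : H.map (MonoidHom.snd S4 S4) = H.map (MonoidHom.fst S4 S4) ∧
      rightPart H = leftPart H := by
    have hc2 : Nat.card (rightPart H) = 1 ∨ Nat.card (rightPart H) = 4 ∨
        Nat.card (rightPart H) = 12 ∨ Nat.card (rightPart H) = 24 ∨
        Nat.card (H.map (MonoidHom.snd S4 S4)) ≤ 8 := by
      by_cases hA : A4 ≤ H.map (MonoidHom.snd S4 S4)
      · rcases hright hA with h | h | h | h <;> rw [h]
        · exact .inl Subgroup.card_bot
        · exact .inr (.inl card_V4)
        · exact .inr (.inr (.inl card_A4))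
        · exact .inr (.inr (.inr (.inl hctop)))
      · rcases h2 with h2 | h2 | h2 | h2 | h2
        · exact absurd (h2 ▸ le_top) hA
        · exact absurd h2.ge hA
        · exact .inr (.inr (.inr (.inr (by rw [h2, card_D4]))))
        · exact .inr (.inr (.inr (.inr (by rw [h2, card_C4]; norm_num))))
        · exact .inr (.inr (.inr (.inr (by rw [h2, card_V4]; norm_num))))
    have hc3 : Nat.card (H.map (MonoidHom.fst S4 S4)) = 24 ∨
        Nat.card (H.map (MonoidHom.fst S4 S4)) = 12 := by
      rcases h1 with h1 | h1 <;> rw [h1]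
      · exact .inl hctop
      · exact .inr card_A4
    have hc4 : Nat.card (H.map (MonoidHom.snd S4 S4)) = 24 ∨
        Nat.card (H.map (MonoidHom.snd S4 S4)) = 12 ∨
        Nat.card (H.map (MonoidHom.snd S4 S4)) = 8 ∨
        Nat.card (H.map (MonoidHom.snd S4 S4)) = 4 := by
      rcases h2 with h2 | h2 | h2 | h2 | h2 <;> rw [h2]
      · exact .inl hctop
      · exact .inr (.inl card_A4)
      · exact .inr (.inr (.inl card_D4))
      · exact .inr (.inr (.inr card_C4))
      · exact .inr (.inr (.inr card_V4))
    -- Both counts of `H` agree. Besides arithmetic, the one case to exclude is orders 24 and 12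
    -- with a right part of order 2, and `A₄` has no normal subgroup of order 2.
    have hkey : Nat.card (H.map (MonoidHom.snd S4 S4)) = Nat.card (H.map (MonoidHom.fst S4 S4)) ∧
        Nat.card (rightPart H) = Nat.card (leftPart H) := by
      generalize Nat.card (H.map (MonoidHom.snd S4 S4)) = n2 at *
      generalize Nat.card (H.map (MonoidHom.fst S4 S4)) = n1 at *
      generalize Nat.card (rightPart H) = r at *
      generalize Nat.card (leftPart H) = l at *
      rcases hclt with rfl | rfl <;> rcases hc3 with rfl | rfl <;>
        rcases hc4 with rfl | rfl | rfl | rfl <;> omega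
    constructor
    · rcases h1 with h1 | h1
      · rw [h1, hctop] at hkey
        rw [h1, eq_top_of_card hkey.1]
      · rw [h1, card_A4] at hkey
        rw [h1, eq_A4_of_card hkey.1]
    · have hA : A4 ≤ H.map (MonoidHom.snd S4 S4) := by
        rcases h1 with h1 | h1
        · rw [h1, hctop] at hkey
          rw [eq_top_of_card hkey.1]
          exact le_top
        · rw [h1, card_A4] at hkey
          rw [eq_A4_of_card hkey.1]
      rcases hlV with h | h
      · rw [h, Subgroup.card_bot] at hkey
        rw [h, hbot hkey.2]
      · rw [h, card_V4] at hkey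
        rw [h]
        rcases hright hA with h | h | h | h
        · rw [h, Subgroup.card_bot] at hkey
          omega
        · exact h
        · rw [h, card_A4] at hkey
          omega
        · rw [h, hctop] at hkey
          omega
  obtain ⟨h2', hr⟩ := hsnd
  have hfin {t : S4} (ht : H.map (MonoidHom.fst S4 S4) ≤ diagonalPart t H) : ∃ r, Fits H r := by
    have e1 := map_fst_relabel t H
    have e2 : (relabel t H).map (MonoidHom.snd S4 S4) = H.map (MonoidHom.fst S4 S4) := by
      rw [map_snd_relabel, h2']
      rcases h1 with h1 | h1 <;> rw [h1]
      · rfl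
      · exact conjBy_of_normal (hN := alternatingGroup.normal) t A4
    rcases h1 with h1 | h1 <;> rcases hlV with hl | hl
    · exact ⟨_, (fits_row04 (e1.trans h1) (e2.trans h1)
        (by rw [rightPart_relabel, hr, hl, conjBy_of_normal])
        fun g => ht (h1 ▸ trivial)).of_relabel⟩
    · exact ⟨_, (fits_row03 (e1.trans h1) (e2.trans h1)
        (by rw [rightPart_relabel, hr, hl, conjBy_of_normal])
        fun g => ht (h1 ▸ trivial)).of_relabel⟩
    · exact ⟨_, (fits_row16 (e1.trans h1) (e2.trans h1)
        (by rw [rightPart_relabel, hr, hl, conjBy_of_normal])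
        fun g hg => ht (h1.symm ▸ hg)).of_relabel⟩
    · exact ⟨_, (fits_row15 (e1.trans h1) (e2.trans h1)
        (by rw [rightPart_relabel, hr, hl, conjBy_of_normal])
        fun g hg => ht (h1.symm ▸ hg)).of_relabel⟩
  rcases hlV with hl | hl
  · obtain ⟨t, ht⟩ := exists_diagonal_of_bot hl (hr.trans hl) h1 h2'
    exact hfin ht
  · obtain ⟨t, ht⟩ := exists_diagonal_of_V4 hl (hr.trans hl) h1
    exact hfin ht

theorem exists_fits
    (h1 : H.map (MonoidHom.fst S4 S4) = ⊤ ∨ H.map (MonoidHom.fst S4 S4) = A4)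
    (h2 : ∀ i j, ∃ g ∈ H.map (MonoidHom.snd S4 S4), g i = j)
    (hcard : Nat.card (H.map (MonoidHom.snd S4 S4)) ≤ Nat.card (H.map (MonoidHom.fst S4 S4))) :
    ∃ r, Fits H r := by
  obtain ⟨t, ht⟩ := exists_conjBy_of_transitive h2
  obtain ⟨r, hr⟩ := exists_fits_of_projections (H := relabel t H) (by rwa [map_fst_relabel])
    (by rwa [map_snd_relabel]) (by rwa [map_fst_relabel, map_snd_relabel, card_conjBy])
  exact ⟨r, hr.of_relabel⟩

end

/-! ### Degrees of intersections of Galois extensions -/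

/-- The fixing subgroups of `A` and `B` meet trivially and generate that of `A ⊓ B`; for normal
subgroups the identity is the product formula for indices. -/
theorem finrank_mul_finrank_of_sup_eq_top {M K : Type*} [Field M] [Field K] [Algebra M K]
    [FiniteDimensional M K] [IsGalois M K] (A B : IntermediateField M K) [IsGalois M A]
    [IsGalois M B] (h : A ⊔ B = ⊤) :
    Module.finrank M A * Module.finrank M B =
      Module.finrank M K * Module.finrank M (A ⊓ B : IntermediateField M K) := by
  have hinf : (A ⊓ B).fixingSubgroup = A.fixingSubgroup ⊔ B.fixingSubgroup :=
    congrArg OrderDual.ofDual (IsGalois.intermediateFieldEquivSubgroup.map_inf A B)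
  have hsup : A.fixingSubgroup ⊓ B.fixingSubgroup = ⊥ := by
    rw [← IntermediateField.fixingSubgroup_sup, h, IntermediateField.fixingSubgroup_top]
  simp only [IntermediateField.finrank_eq_fixingSubgroup_index]
  rw [hinf, ← IsGalois.card_aut_eq_finrank]
  have e1 := Subgroup.relIndex_mul_index
    (le_sup_left : A.fixingSubgroup ≤ A.fixingSubgroup ⊔ B.fixingSubgroup)
  rw [Subgroup.relIndex_sup_left] at e1
  have e2 := Subgroup.relIndex_mul_index (bot_le : ⊥ ≤ B.fixingSubgroup)
  rw [← hsup, Subgroup.inf_relIndex_right, hsup, Subgroup.index_bot] at e2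
  rw [← e1, ← e2]
  ring

theorem finrank_mul_finrank_eq {M Ω : Type*} [Field M] [Field Ω] [Algebra M Ω]
    (L L' : IntermediateField M Ω) [IsGalois M L] [IsGalois M L'] [FiniteDimensional M L]
    [FiniteDimensional M L'] :
    Module.finrank M L * Module.finrank M L' =
      Module.finrank M (L ⊔ L' : IntermediateField M Ω) *
        Module.finrank M (L ⊓ L' : IntermediateField M Ω) := by
  have hL : L ≤ L ⊔ L' := le_sup_left
  have hL' : L' ≤ L ⊔ L' := le_sup_right
  let A := IntermediateField.restrict hL
  let B := IntermediateField.restrict hL'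
  have : IsGalois M A := IsGalois.of_algEquiv (IntermediateField.restrictAlgEquiv hL)
  have : IsGalois M B := IsGalois.of_algEquiv (IntermediateField.restrictAlgEquiv hL')
  have htop : A ⊔ B = ⊤ := by
    rw [← IntermediateField.lift_inj, IntermediateField.lift_sup, IntermediateField.lift_restrict,
      IntermediateField.lift_restrict, IntermediateField.lift_top]
  have hinf : IntermediateField.lift (A ⊓ B) = L ⊓ L' := by
    rw [IntermediateField.lift_inf, IntermediateField.lift_restrict,
      IntermediateField.lift_restrict]
  have e := finrank_mul_finrank_of_sup_eq_top A B htop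
  rw [← (IntermediateField.restrictAlgEquiv hL).toLinearEquiv.finrank_eq,
    ← (IntermediateField.restrictAlgEquiv hL').toLinearEquiv.finrank_eq,
    (IntermediateField.liftAlgEquiv (A ⊓ B)).toLinearEquiv.finrank_eq, hinf] at e
  exact e

/-! ### Galois groups and orderings of the roots -/

section Roots

variable {M : Type*} [Field M] {Ω : Type*} [Field Ω] [Algebra M Ω]

theorem IsRootOrdering.aroots_eq {n : ℕ} {f : M[X]} {α : Fin n → Ω} (h : IsRootOrdering f α) :
    f.aroots Ω = Finset.univ.val.map α := by
  have := roots_multiset_prod_X_sub_C (Finset.univ.val.map α)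
  rw [Multiset.map_map] at this
  rw [aroots, h]
  exact this

theorem IsRootOrdering.injective {n : ℕ} {f : M[X]} {α : Fin n → Ω} (h : IsRootOrdering f α)
    (hf : f.Separable) : Function.Injective α :=
  separable_prod_X_sub_C_iff.1 (h ▸ hf.map)

theorem IsRootOrdering.monic {n : ℕ} {f : M[X]} {α : Fin n → Ω} (h : IsRootOrdering f α) :
    f.Monic := by
  have : (f.map (algebraMap M Ω)).Monic := by
    rw [h]
    exact monic_prod_of_monic _ _ fun i _ => monic_X_sub_C _
  exact monic_of_injective (algebraMap M Ω).injective this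

theorem IsRootOrdering.mem_rootSet {n : ℕ} {f : M[X]} {α : Fin n → Ω} (h : IsRootOrdering f α)
    {x : Ω} : x ∈ f.rootSet Ω ↔ ∃ i, α i = x := by
  classical
  rw [rootSet, Finset.mem_coe, Multiset.mem_toFinset, h.aroots_eq]
  simp

theorem exists_isRootOrdering [IsAlgClosed Ω] {n : ℕ} {f : M[X]} (hf : f.Monic)
    (hn : f.natDegree = n) : ∃ α : Fin n → Ω, IsRootOrdering f α := by
  have hs := IsAlgClosed.splits (f.map (algebraMap M Ω))
  have hcard : (f.aroots Ω).toList.length = n := by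
    rw [Multiset.length_toList, ← hn, ← hf.natDegree_map (algebraMap M Ω)]
    exact hs.natDegree_eq_card_roots.symm
  refine ⟨fun i => (f.aroots Ω).toList.get (Fin.cast hcard.symm i), ?_⟩
  subst hcard
  rw [IsRootOrdering, hs.eq_prod_roots_of_monic (hf.map _)]
  have h2 : ∏ i, (X - C ((f.aroots Ω).toList.get i)) =
      ((f.aroots Ω).toList.map fun x => X - C x).prod := by
    rw [← List.prod_ofFn]
    congr 1
    conv_rhs => rw [← List.ofFn_get (f.aroots Ω).toList, List.map_ofFn]
    rfl
  rw [← Multiset.prod_coe, ← Multiset.map_coe, Multiset.coe_toList] at h2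
  exact h2.symm

theorem IsRootOrdering.exists_perm {n : ℕ} {f : M[X]} {α α' : Fin n → Ω}
    (h : IsRootOrdering f α) (h' : IsRootOrdering f α') (hf : f.Separable) :
    ∃ p : Equiv.Perm (Fin n), ∀ i, α' i = α (p i) := by
  have hex : ∀ i, ∃ j, α j = α' i := fun i => h.mem_rootSet.1 (h'.mem_rootSet.2 ⟨i, rfl⟩)
  choose p hp using hex
  have hinj : Function.Injective p := fun i j hij => h'.injective hf (by rw [← hp, ← hp, hij])
  exact ⟨Equiv.ofBijective p (Finite.injective_iff_bijective.1 hinj), fun i => (hp i).symm⟩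

/-- The action of the automorphisms on the indices of the roots. -/
theorem IsRootOrdering.exists_hom {n : ℕ} {f : M[X]} {α : Fin n → Ω} (h : IsRootOrdering f α)
    (hf : f.Separable) :
    ∃ ρ : Gal(Ω/M) →* Equiv.Perm (Fin n), ∀ σ i, σ (α i) = α (ρ σ i) := by
  have hinj := h.injective hf
  have hmap : ∀ (σ : Gal(Ω/M)), IsRootOrdering f fun i => σ (α i) := by
    intro σ
    have h1 := congrArg (Polynomial.map (σ : Ω →+* Ω)) h
    rw [Polynomial.map_map, Polynomial.map_prod] at h1
    have h2 : ((σ : Ω →+* Ω).comp (algebraMap M Ω)) = algebraMap M Ω := by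
      ext x
      exact σ.commutes x
    rw [h2] at h1
    rw [IsRootOrdering, h1]
    simp
  choose p hp using fun σ => h.exists_perm (hmap σ) hf
  refine ⟨MonoidHom.mk' p fun σ τ => ?_, hp⟩
  ext1 i
  apply hinj
  rw [← hp, Equiv.Perm.mul_apply, ← hp, ← hp]
  rfl

/-- Both groups are the quotient of `Gal(Ω/M)` by the automorphisms fixing all roots of `f`. -/
theorem nonempty_gal_mulEquiv_range [IsAlgClosed Ω] [Normal M Ω] (f : M[X]) {P : Type*} [Group P]
    (ρ : Gal(Ω/M) →* P) (h : ∀ σ, ρ σ = 1 ↔ ∀ x ∈ f.rootSet Ω, σ x = x) :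
    Nonempty (f.Gal ≃* ρ.range) := by
  have hs : Fact (f.map (algebraMap M Ω)).Splits := ⟨IsAlgClosed.splits _⟩
  have hker : (Gal.restrict f Ω).ker = ρ.ker := by
    ext σ
    rw [MonoidHom.mem_ker, MonoidHom.mem_ker, h,
      ← (Gal.galActionHom_injective f Ω).eq_iff, map_one, Equiv.ext_iff]
    constructor
    · intro hx x hxf
      rw [← Gal.galActionHom_restrict f Ω σ ⟨x, hxf⟩, hx]
      rfl
    · rintro hx ⟨x, hxf⟩
      apply Subtype.ext
      rw [Gal.galActionHom_restrict]
      exact hx x hxf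
  exact ⟨((QuotientGroup.quotientKerEquivOfSurjective _ (Gal.restrict_surjective f Ω)).symm.trans
    (QuotientGroup.quotientMulEquivOfEq hker)).trans (QuotientGroup.quotientKerEquivRange ρ)⟩

theorem isSplittingField_splittingFieldIn [IsAlgClosed Ω] (f : M[X]) :
    f.IsSplittingField M (splittingFieldIn Ω f) :=
  IntermediateField.adjoin_rootSet_isSplittingField (IsAlgClosed.splits _)

theorem finiteDimensional_splittingFieldIn [IsAlgClosed Ω] (f : M[X]) :
    FiniteDimensional M (splittingFieldIn Ω f) :=
  have := isSplittingField_splittingFieldIn (Ω := Ω) f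
  IsSplittingField.finiteDimensional _ f

theorem isGalois_splittingFieldIn [IsAlgClosed Ω] {f : M[X]} (hf : f.Separable) :
    IsGalois M (splittingFieldIn Ω f) :=
  have := isSplittingField_splittingFieldIn (Ω := Ω) f
  IsGalois.of_separable_splitting_field hf

theorem finrank_splittingFieldIn [IsAlgClosed Ω] (f : M[X]) [IsGalois M (splittingFieldIn Ω f)] :
    Module.finrank M (splittingFieldIn Ω f) = Nat.card f.Gal := by
  have := isSplittingField_splittingFieldIn (Ω := Ω) f
  have := finiteDimensional_splittingFieldIn (Ω := Ω) f
  rw [← IsGalois.card_aut_eq_finrank]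
  exact Nat.card_congr (AlgEquiv.autCongr (IsSplittingField.algEquiv _ f)).toEquiv

theorem rootSet_mul {f g : M[X]} (h : f * g ≠ 0) :
    (f * g).rootSet Ω = f.rootSet Ω ∪ g.rootSet Ω := by
  classical
  rw [rootSet, aroots_mul h, Multiset.toFinset_add, Finset.coe_union]
  rfl

theorem splittingFieldIn_mul {f g : M[X]} (h : f * g ≠ 0) :
    splittingFieldIn Ω (f * g) = splittingFieldIn Ω f ⊔ splittingFieldIn Ω g := by
  rw [splittingFieldIn, rootSet_mul h, IntermediateField.adjoin_union]
  rfl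

theorem card_gal_mul_card_gal [IsAlgClosed Ω] {f g : M[X]} (hf : f.Separable) (hg : g.Separable) :
    Nat.card f.Gal * Nat.card g.Gal = Nat.card (f * g).Gal *
      Module.finrank M (splittingFieldIn Ω f ⊓ splittingFieldIn Ω g : IntermediateField M Ω) := by
  have := isGalois_splittingFieldIn (Ω := Ω) hf
  have := isGalois_splittingFieldIn (Ω := Ω) hg
  have := finiteDimensional_splittingFieldIn (Ω := Ω) f
  have := finiteDimensional_splittingFieldIn (Ω := Ω) g
  have hmul := splittingFieldIn_mul (Ω := Ω) (mul_ne_zero hf.ne_zero hg.ne_zero)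
  have : IsGalois M (splittingFieldIn Ω (f * g)) := hmul ▸ inferInstance
  rw [← finrank_splittingFieldIn (Ω := Ω) f, ← finrank_splittingFieldIn (Ω := Ω) g,
    ← finrank_splittingFieldIn (Ω := Ω) (f * g), finrank_mul_finrank_eq, hmul]

end Roots

/-! ### Polynomials with prescribed separable roots -/

section Factorization

variable {M : Type*} [Field M] {Ω : Type*} [Field Ω] [Algebra M Ω]

/-- `Ω` may be inseparable over `M`; the separability of `x` is what provides a second conjugate
when `x` is not in `M`. -/
theorem mem_range_of_fixed [IsAlgClosed Ω] [Normal M Ω] {x : Ω} (hx : IsSeparable M x)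
    (h : ∀ σ : Gal(Ω/M), σ x = x) : x ∈ Set.range (algebraMap M Ω) := by
  rw [← IntermediateField.mem_bot]
  by_contra hbot
  obtain ⟨y, hxy, hconj⟩ :=
    (notMem_iff_exists_ne_and_isConjRoot hx (IsAlgClosed.splits _)).1 hbot
  obtain ⟨σ, hσ⟩ := isConjRoot_iff_exists_algEquiv.1 hconj.symm
  exact hxy ((h σ).symm.trans hσ)

variable {ι : Type*} [Fintype ι]

/-- A product of linear factors descends to `M` if its roots are separable and permuted by the
automorphisms. -/
theorem exists_map_eq_prod [IsAlgClosed Ω] [Normal M Ω] {r : ι → Ω}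
    (hsep : ∀ i, IsSeparable M (r i))
    (hperm : ∀ σ : Gal(Ω/M), ∃ p : Equiv.Perm ι, ∀ i, σ (r i) = r (p i)) :
    ∃ R : M[X], R.map (algebraMap M Ω) = ∏ i, (X - C (r i)) := by
  suffices ∏ i, (X - C (r i)) ∈ lifts (algebraMap M Ω) from (mem_lifts _).1 this
  rw [lifts_iff_coeff_lifts]
  intro n
  apply mem_range_of_fixed
  -- The product is already defined over the separable closure, so its coefficients are separable.
  · let S : (separableClosure M Ω)[X] :=
      ∏ i, (X - C ⟨r i, mem_separableClosure_iff.2 (hsep i)⟩)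
    have hS : S.map (algebraMap (separableClosure M Ω) Ω) = ∏ i, (X - C (r i)) := by
      simp only [S, Polynomial.map_prod, Polynomial.map_sub, map_X, map_C]
      rfl
    rw [← hS, coeff_map]
    exact mem_separableClosure_iff.1 (S.coeff n).2
  · intro σ
    obtain ⟨p, hp⟩ := hperm σ
    have : (∏ i, (X - C (r i))).map (σ : Ω →+* Ω) = ∏ i, (X - C (r i)) := by
      rw [Polynomial.map_prod, ← Equiv.prod_comp p fun i => X - C (r i)]
      refine Finset.prod_congr rfl fun i _ => ?_
      rw [← hp, Polynomial.map_sub, map_X, map_C]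
      rfl
    conv_rhs => rw [← this, coeff_map]
    rfl

/-- A squarefree polynomial with separable roots has no multiple roots. -/
theorem injective_of_squarefree {r : ι → Ω} (hsep : ∀ i, IsSeparable M (r i)) {R : M[X]}
    (hR : R.map (algebraMap M Ω) = ∏ i, (X - C (r i))) (hsq : Squarefree R) :
    Function.Injective r := by
  classical
  intro i j hij
  by_contra hne
  have hint : IsIntegral M (r i) := (hsep i).isIntegral
  have hroot : aeval (r i) R = 0 := by
    rw [aeval_def, ← eval_map, hR, eval_prod]
    exact Finset.prod_eq_zero (Finset.mem_univ i) (by simp)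
  obtain ⟨Q, hQ⟩ := minpoly.dvd M (r i) hroot
  have hR0 : R.map (algebraMap M Ω) ≠ 0 := by
    rw [hR]
    exact (monic_prod_of_monic _ _ fun i _ => monic_X_sub_C _).ne_zero
  have hmult : 2 ≤ rootMultiplicity (r i) (R.map (algebraMap M Ω)) := by
    rw [le_rootMultiplicity_iff hR0, hR, ← Finset.mul_prod_erase _ _ (Finset.mem_univ i),
      ← Finset.mul_prod_erase _ _ (Finset.mem_erase.2 ⟨Ne.symm hne, Finset.mem_univ j⟩), ← hij,
      ← mul_assoc, sq]
    exact dvd_mul_right _ _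
  -- The separable minimal polynomial accounts for only one of the two multiplicities, so it also
  -- divides the cofactor and its square divides `R`.
  have hP := rootMultiplicity_le_one_of_separable
    (Separable.map (f := algebraMap M Ω) (hsep i)) (r i)
  have hQ' := hQ
  apply_fun Polynomial.map (algebraMap M Ω) at hQ'
  rw [Polynomial.map_mul] at hQ'
  rw [hQ', rootMultiplicity_mul (hQ' ▸ hR0)] at hmult
  have hQm : 0 < rootMultiplicity (r i) (Q.map (algebraMap M Ω)) := by omega
  have hQr : aeval (r i) Q = 0 := by
    have := (rootMultiplicity_pos'.1 hQm).2
    rwa [IsRoot, eval_map, ← aeval_def] at this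
  obtain ⟨Q', rfl⟩ := minpoly.dvd M (r i) hQr
  have hu : IsUnit (minpoly M (r i)) := hsq _ ⟨Q', by rw [hQ, mul_assoc]⟩
  exact minpoly.not_isUnit M (r i) hu

/-- The degrees of the irreducible factors are the sizes of the orbits of the roots. -/
theorem factorDegrees_eq [IsAlgClosed Ω] [Normal M Ω] {r : ι → Ω}
    (hsep : ∀ i, IsSeparable M (r i)) {R : M[X]}
    (hR : R.map (algebraMap M Ω) = ∏ i, (X - C (r i))) (hsq : Squarefree R) (κ : ι → ℕ)
    (hκ : ∀ i j, κ i = κ j ↔ ∃ σ : Gal(Ω/M), σ (r i) = r j) :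
    factorDegrees R =
      (Finset.univ.image κ).val.map fun k => (Finset.univ.filter fun i => κ i = k).card := by
  classical
  have hinj := injective_of_squarefree hsep hR hsq
  -- The conjugates of `r i` are its images under automorphisms, that is, the roots indexed by the
  -- fibre of `κ` through `i`.
  have hmin : ∀ i, (minpoly M (r i)).map (algebraMap M Ω) =
      ∏ j with κ j = κ i, (X - C (r j)) := by
    intro i
    have hint : IsIntegral M (r i) := (hsep i).isIntegral
    have hs := IsAlgClosed.splits ((minpoly M (r i)).map (algebraMap M Ω))
    have hroots : ((minpoly M (r i)).map (algebraMap M Ω)).roots =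
        (Finset.univ.filter fun j => κ j = κ i).val.map r := by
      rw [Multiset.Nodup.ext (nodup_roots (Separable.map (hsep i)))
        ((Finset.nodup _).map hinj)]
      intro y
      rw [mem_roots_map (minpoly.ne_zero hint), ← aeval_def,
        ← isConjRoot_iff_aeval_eq_zero hint, Multiset.mem_map]
      constructor
      · intro hy
        obtain ⟨σ, hσ⟩ := isConjRoot_iff_exists_algEquiv.1 hy.symm
        have hroot : aeval y R = 0 := by
          have h1 : aeval (r i) R = 0 := by
            rw [aeval_def, ← eval_map, hR, eval_prod]
            exact Finset.prod_eq_zero (Finset.mem_univ i) (by simp)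
          rw [← hσ, ← AlgEquiv.coe_toAlgHom, aeval_algHom_apply, h1, map_zero]
        rw [aeval_def, ← eval_map, hR, eval_prod, Finset.prod_eq_zero_iff] at hroot
        obtain ⟨j, -, hj⟩ := hroot
        rw [eval_sub, eval_X, eval_C, sub_eq_zero] at hj
        subst hj
        exact ⟨j, by simpa using ((hκ i j).2 ⟨σ, hσ⟩).symm, rfl⟩
      · rintro ⟨j, hj, rfl⟩
        have hj' : κ j = κ i := by simpa using hj
        obtain ⟨σ, hσ⟩ := (hκ i j).1 hj'.symm
        exact (isConjRoot_iff_exists_algEquiv.2 ⟨σ, hσ⟩).symm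
    rw [hs.eq_prod_roots_of_monic ((minpoly.monic hint).map _), hroots, Multiset.map_map]
    rfl
  have hex : ∀ k ∈ Finset.univ.image κ, ∃ i, κ i = k := fun k hk => by simpa using hk
  let Q : ℕ → M[X] := fun k => if h : ∃ i, κ i = k then minpoly M (r h.choose) else 1
  have hQ : ∀ k ∈ Finset.univ.image κ, Irreducible (Q k) ∧ (Q k).map (algebraMap M Ω) =
      ∏ j with κ j = k, (X - C (r j)) := by
    intro k hk
    have h := hex k hk
    have hc : Q k = minpoly M (r h.choose) := dif_pos h
    rw [hc, hmin, h.choose_spec]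
    exact ⟨minpoly.irreducible (hsep _).isIntegral, rfl⟩
  have hprod : ((Finset.univ.image κ).val.map Q).prod = R := by
    apply Polynomial.map_injective _ (algebraMap M Ω).injective
    rw [hR, ← Finset.prod_fiberwise_of_maps_to (t := Finset.univ.image κ) (g := κ)
      (fun i _ => Finset.mem_image_of_mem _ (Finset.mem_univ i))]
    change (∏ k ∈ Finset.univ.image κ, Q k).map _ = _
    rw [Polynomial.map_prod]
    exact Finset.prod_congr rfl fun k hk => (hQ k hk).2
  -- Factors are unique only up to units, which do not affect degrees.
  have hrel : Multiset.Rel Associated (UniqueFactorizationMonoid.factors R)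
      ((Finset.univ.image κ).val.map Q) := by
    apply UniqueFactorizationMonoid.factors_unique
    · exact fun x hx => UniqueFactorizationMonoid.irreducible_of_factor x hx
    · intro x hx
      obtain ⟨k, hk, rfl⟩ := Multiset.mem_map.1 hx
      exact (hQ k hk).1
    · rw [hprod]
      exact UniqueFactorizationMonoid.factors_prod hsq.ne_zero
  have hdeg : factorDegrees R = ((Finset.univ.image κ).val.map Q).map natDegree := by
    rw [factorDegrees, ← Multiset.rel_eq, Multiset.rel_map]
    exact hrel.mono fun a _ b _ hab => natDegree_eq_of_degree_eq (degree_eq_degree_of_associated hab)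
  rw [hdeg, Multiset.map_map]
  refine Multiset.map_congr rfl fun k hk => ?_
  rw [Function.comp_apply, ← natDegree_map (algebraMap M Ω), (hQ k hk).2,
    natDegree_prod_of_monic _ _ fun i _ => monic_X_sub_C _]
  simp

end Factorization

/-! ### Multi-resolvents -/

section Resolvent

variable {M : Type*} [Field M] {Ω : Type*} [Field Ω] [Algebra M Ω]

/-- The values of `x₀y₀ + x₁y₁ + x₂y₂ + x₃y₃` which are the roots of the multi-resolvent of the
Tschirnhausen transformations given by `c` and `d`. -/
noncomputable def resolventValue (α β : Fin 4 → Ω) (c d : M[X]) (π : S4) : Ω :=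
  ∑ i, aeval (α i) c * aeval (β (π i)) d

/-- Reindexing the sum by `s` turns the action on the roots into `π ↦ t π s⁻¹`. -/
theorem apply_resolventValue {α β : Fin 4 → Ω} (c d : M[X]) (π : S4) {σ : Gal(Ω/M)} {s t : S4}
    (hs : ∀ i, σ (α i) = α (s i)) (ht : ∀ i, σ (β i) = β (t i)) :
    σ (resolventValue α β c d π) = resolventValue α β c d (t * π * s⁻¹) := by
  have h (x : Ω) (e : M[X]) : σ (aeval x e) = aeval (σ x) e := by
    rw [← AlgEquiv.coe_toAlgHom, aeval_algHom_apply]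
  rw [resolventValue, resolventValue, map_sum, ← Equiv.sum_comp s fun i =>
    aeval (α i) c * aeval (β ((t * π * s⁻¹) i)) d]
  refine Finset.sum_congr rfl fun i _ => ?_
  rw [map_mul, h, h, hs, ht]
  simp

theorem IsRootOrdering.isSeparable {n : ℕ} {f : M[X]} {α : Fin n → Ω} (h : IsRootOrdering f α)
    (hf : f.Separable) (i : Fin n) : IsSeparable M (α i) := by
  refine Separable.of_dvd hf (minpoly.dvd M _ ?_)
  have := h.mem_rootSet.2 ⟨i, rfl⟩
  exact aeval_eq_zero_of_mem_rootSet this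

theorem isSeparable_aeval {x : Ω} (hx : IsSeparable M x) (c : M[X]) :
    IsSeparable M (aeval x c) := by
  let y : separableClosure M Ω := ⟨x, mem_separableClosure_iff.2 hx⟩
  rw [← mem_separableClosure_iff, show aeval x c = ((aeval y c : separableClosure M Ω) : Ω) from
    (IntermediateField.aeval_coe _ y c)]
  exact (aeval y c).2

theorem isSeparable_resolventValue {α β : Fin 4 → Ω} (hα : ∀ i, IsSeparable M (α i))
    (hβ : ∀ i, IsSeparable M (β i)) (c d : M[X]) (π : S4) :
    IsSeparable M (resolventValue α β c d π) := by
  rw [← mem_separableClosure_iff]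
  exact sum_mem fun i _ => mul_mem (mem_separableClosure_iff.2 (isSeparable_aeval (hα i) c))
    (mem_separableClosure_iff.2 (isSeparable_aeval (hβ (π i)) d))

/-- Reordering the roots only reindexes the product, by `π ↦ q π p⁻¹`. -/
theorem rootResolvent_perm {α β : Fin 4 → Ω} (c d : M[X]) (p q : S4) :
    rootResolvent (fun i => aeval (α (p i)) c) (fun i => aeval (β (q i)) d) =
      ∏ π, (X - C (resolventValue α β c d π)) := by
  rw [rootResolvent, ← Equiv.prod_comp ((Equiv.mulLeft q).trans (Equiv.mulRight p⁻¹))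
    fun π => X - C (resolventValue α β c d π)]
  refine Finset.prod_congr rfl fun π _ => ?_
  rw [resolventValue, ← Equiv.sum_comp p fun i =>
    aeval (α i) c * aeval (β (((Equiv.mulLeft q).trans (Equiv.mulRight p⁻¹)) π i)) d]
  simp

/-- The orderings of the roots of a Tschirnhausen transformation. -/
theorem IsTschirnhausen.exists_aeval {f f' : M[X]} {α α' : Fin 4 → Ω} (h : IsTschirnhausen Ω f f')
    (hf : f.Separable) (hn : f.natDegree = 4) (hα : IsRootOrdering f α)
    (hα' : IsRootOrdering f' α') :
    ∃ (c : M[X]) (p : S4), ∀ i, α' i = aeval (α (p i)) c := by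
  obtain ⟨hf', c, -, γ, hγ, hγ'⟩ := h
  revert γ
  rw [hn]
  intro γ hγ hγ'
  obtain ⟨p, hp⟩ := hα.exists_perm hγ hf
  obtain ⟨q, hq⟩ := hγ'.exists_perm hα' hf'
  exact ⟨c, p * q, fun i => by rw [hq, hp, Equiv.Perm.mul_apply]⟩

theorem isTschirnhausen_of_aeval {f f' c : M[X]} {α : Fin 4 → Ω} (hn : f.natDegree = 4)
    (hα : IsRootOrdering f α) (hf' : f'.Separable) (hc : c.degree < f.degree)
    (h : IsRootOrdering f' fun i => aeval (α i) c) : IsTschirnhausen Ω f f' := by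
  refine ⟨hf', c, hc, ?_⟩
  rw [hn]
  exact ⟨α, hα, h⟩

/-- It is enough to transform the second quartic. Each coincidence to be avoided is a linear
condition on `d` in the polynomials of degree less than 4, and a vector space over an infinite field
is not a finite union of proper subspaces. -/
theorem exists_tschirnhausen_poly [Infinite M] {α β : Fin 4 → Ω} (hα : Function.Injective α)
    (hβ : Function.Injective β) : ∃ d : M[X], d.degree < 4 ∧
      Function.Injective (fun i => aeval (β i) d) ∧
      Function.Injective (resolventValue α β (X : M[X]) d) := by
  let ev (x : Ω) : degreeLT M 4 →ₗ[M] Ω := (aeval x).toLinearMap.comp (degreeLT M 4).subtype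
  have hX (k : Fin 4) : (X ^ (k : ℕ) : M[X]) ∈ degreeLT M 4 := by
    rw [mem_degreeLT, degree_X_pow]
    exact_mod_cast k.2
  let φ : S4 → degreeLT M 4 →ₗ[M] Ω := fun π => ∑ i, (α i) • ev (β (π i))
  have hφ (π : S4) (d : degreeLT M 4) : φ π d = resolventValue α β X d.1 π := by
    simp [φ, resolventValue, ev]
  let ι := {x : Fin 4 × Fin 4 // x.1 ≠ x.2} ⊕ {x : S4 × S4 // x.1 ≠ x.2}
  let U : ι → Subspace M (degreeLT M 4) := Sum.elim
    (fun x => LinearMap.ker (ev (β x.1.1) - ev (β x.1.2)))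
    (fun x => LinearMap.ker (φ x.1.1 - φ x.1.2))
  have hU : ∀ i, U i ≠ ⊤ := by
    rintro (⟨⟨i, j⟩, hij⟩ | ⟨⟨π, π'⟩, hne⟩) htop
    · have h := LinearMap.ker_eq_top.1 htop
      have h1 := LinearMap.congr_fun h ⟨X ^ ((1 : Fin 4) : ℕ), hX 1⟩
      have h2 : β i - β j = 0 := by simpa [ev] using h1
      exact hij (hβ (sub_eq_zero.1 h2))
    · have h := LinearMap.ker_eq_top.1 htop
      -- If two values agreed for every `d`, testing on `1, X, X², X³` would give a vector
      -- annihilated by the Vandermonde matrix of the distinct `β j`.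
      have hw : (fun j => α (π⁻¹ j) - α (π'⁻¹ j)) = 0 := by
        apply Matrix.eq_zero_of_forall_pow_sum_mul_pow_eq_zero hβ
        intro k
        have h1 := LinearMap.congr_fun h ⟨X ^ (k : ℕ), hX k⟩
        rw [LinearMap.sub_apply, hφ, hφ, LinearMap.zero_apply, resolventValue, resolventValue,
          ← Equiv.sum_comp π⁻¹, ← Equiv.sum_comp π'⁻¹ fun i =>
            aeval (α i) (X : M[X]) * aeval (β (π' i)) (X ^ (k : ℕ) : M[X])] at h1
        rw [← h1, ← Finset.sum_sub_distrib]
        refine Finset.sum_congr rfl fun j _ => ?_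
        simp
        ring
      apply hne
      rw [← inv_inj]
      ext1 j
      exact hα (sub_eq_zero.1 (congrFun hw j))
  have hcov : ⋃ i, (U i : Set (degreeLT M 4)) ≠ Set.univ := fun h => by
    obtain ⟨i, hi⟩ := Subspace.exists_eq_top_of_iUnion_eq_univ h
    exact hU i hi
  obtain ⟨d, hd⟩ := (Set.ne_univ_iff_exists_notMem _).1 hcov
  rw [Set.mem_iUnion, not_exists] at hd
  refine ⟨d.1, by simpa using mem_degreeLT.1 d.2, fun i j hij => ?_, fun π π' h => ?_⟩
  · by_contra hne
    refine hd (.inl ⟨(i, j), hne⟩) ?_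
    change (ev (β i) - ev (β j)) d = 0
    exact sub_eq_zero.2 hij
  · by_contra hne
    refine hd (.inr ⟨(π, π'), hne⟩) ?_
    change (φ π - φ π') d = 0
    rw [LinearMap.sub_apply, hφ, hφ]
    exact sub_eq_zero.2 h

theorem separable_of_map_eq_prod {ι : Type*} [Fintype ι] {R : M[X]} {r : ι → Ω}
    (h : R.map (algebraMap M Ω) = ∏ i, (X - C (r i))) (hr : Function.Injective r) :
    R.Separable := by
  rw [← separable_map (algebraMap M Ω), h, separable_prod_X_sub_C_iff]
  exact hr

end Resolvent

/-! ### Uniqueness of the row -/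

/-- The orders of the groups. -/
def QuarticType.card : QuarticType → ℕ
  | .S4 => 24
  | .A4 => 12
  | .D4 => 8
  | .C4 => 4
  | .V4 => 4

theorem QuarticType.Is.card_eq {G : Type*} [Group G] {q : QuarticType} (h : q.Is G) :
    Nat.card G = q.card := by
  cases q <;> obtain ⟨e⟩ := h <;> rw [Nat.card_congr e.toEquiv]
  exacts [card_S4, card_A4, DihedralGroup.nat_card, card_C4, card_V4]

theorem not_C4_and_V4 {G : Type*} [Group G] (h : QuarticType.C4.Is G) (h' : QuarticType.V4.Is G) :
    False := by
  obtain ⟨e⟩ := h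
  obtain ⟨e'⟩ := h'
  have hV : ∀ v ∈ V4, v ^ 2 = 1 := by decide
  let c : C4 := ⟨fourCycle, Subgroup.mem_zpowers _⟩
  have h1 : (e' (e.symm c)) ^ 2 = 1 := Subtype.ext (hV _ (e' (e.symm c)).2)
  rw [← map_pow, ← map_pow, EmbeddingLike.map_eq_one_iff, EmbeddingLike.map_eq_one_iff] at h1
  have h2 : fourCycle ^ 2 = 1 := congrArg Subtype.val h1
  exact absurd h2 (by decide)

theorem QuarticType.Is.unique {G : Type*} [Group G] {q q' : QuarticType} (h : q.Is G)
    (h' : q'.Is G) : q = q' := by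
  have hc := h.card_eq.symm.trans h'.card_eq
  cases q <;> cases q' <;> first | rfl | (exfalso; revert hc; decide) |
    exact (not_C4_and_V4 h h').elim | exact (not_C4_and_V4 h' h).elim

theorem conjSemidirect_hom_injective {G : Type*} [Group G] {N Q : Subgroup G}
    (h : Q ≤ Subgroup.normalizer (N : Set G)) (hdisj : ∀ x ∈ N, x ∈ Q → x = 1) :
    Function.Injective (SemidirectProduct.monoidHomSubgroup h) := by
  rw [injective_iff_map_eq_one]
  intro x hx
  have h1 : x.left.1 * x.right.1 = 1 := hx
  have h2 : x.left.1 = 1 := by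
    refine hdisj _ x.left.2 ?_
    rw [eq_inv_of_mul_eq_one_left h1]
    exact inv_mem x.right.2
  rw [h2, one_mul] at h1
  ext
  · exact h2
  · exact h1

/-- The pair of a 3-cycle and a 4-cycle has order 12. -/
theorem A4C4_C2_exists : ∃ x : A4C4_C2, x ^ 4 ≠ 1 ∧ x ^ 6 ≠ 1 := by
  refine ⟨SemidirectProduct.inl ⟨(threeCycle, fourCycle),
    show threeCycle ∈ A4 by decide, show fourCycle ∈ C4 by decide⟩, ?_, ?_⟩ <;>
  · intro h
    rw [← map_pow, ← map_one SemidirectProduct.inl, SemidirectProduct.inl_inj] at h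
    have h' := congrArg Subtype.val h
    revert h'
    decide

set_option maxRecDepth 10000 in
-- Elements of `A₄ × V₄` have order dividing 6. In the other coset both components lie in cosets
-- whose elements have order dividing 4.
theorem A4V4_C2_forall (x : A4V4_C2) : x ^ 4 = 1 ∨ x ^ 6 = 1 := by
  have h2 : (transposition, reflection) ^ 2 = 1 := by decide
  have hinj := conjSemidirect_hom_injective (le_normalizer_of_normal (A4.prod V4)
    (Subgroup.zpowers ((transposition, reflection) : S4 × S4))) (by
      intro x hx hx'
      obtain ⟨k, hk, rfl⟩ := mem_zpowers_iff_of_pow (by norm_num) h2 hx'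
      interval_cases k
      · rfl
      · exact absurd (show transposition ∈ A4 from hx.1) (by decide))
  rw [← hinj.eq_iff, ← hinj.eq_iff, map_pow, map_pow, map_one]
  have hx : SemidirectProduct.monoidHomSubgroup (le_normalizer_of_normal (A4.prod V4)
    (Subgroup.zpowers ((transposition, reflection) : S4 × S4))) x = x.left.1 * x.right.1 := rfl
  rw [hx]
  obtain ⟨k, hk, hq⟩ := mem_zpowers_iff_of_pow (by norm_num) h2 x.right.2
  obtain ⟨a, v, ha, hv, hav⟩ : ∃ a v, a ∈ A4 ∧ v ∈ V4 ∧ x.left.1 = (a, v) :=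
    ⟨_, _, x.left.2.1, x.left.2.2, rfl⟩
  rw [hq, hav]
  interval_cases k
  · have e1 : ∀ a ∈ A4, (a * 1) ^ 6 = 1 := by decide
    have e2 : ∀ v ∈ V4, (v * 1) ^ 6 = 1 := by decide
    exact Or.inr (Prod.ext (e1 a ha) (e2 v hv))
  · have e1 : ∀ a ∈ A4, (a * transposition) ^ 4 = 1 := by decide
    have e2 : ∀ v ∈ V4, (v * reflection) ^ 4 = 1 := by decide
    rw [pow_one]
    exact Or.inl (Prod.ext (e1 a ha) (e2 v hv))

theorem not_A4C4_C2_and_A4V4_C2 {G : Type*} [Group G] (h : Nonempty (G ≃* A4C4_C2))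
    (h' : Nonempty (G ≃* A4V4_C2)) : False := by
  obtain ⟨e⟩ := h
  obtain ⟨e'⟩ := h'
  obtain ⟨x, h4, h6⟩ := A4C4_C2_exists
  rcases A4V4_C2_forall (e' (e.symm x)) with h | h <;>
    rw [← map_pow, ← map_pow, EmbeddingLike.map_eq_one_iff, EmbeddingLike.map_eq_one_iff] at h
  exacts [h4 h, h6 h]

/-- The types of the groups, the decomposition type and the degree of the intersection determine
the row, except that they do not distinguish the rows 7 and 8. -/
theorem TableRow.eq_of_entries {r r' : TableRow} (h1 : r.first = r'.first)
    (h2 : r.second = r'.second) (h3 : r.decType = r'.decType) (h4 : r.degree = r'.degree) :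
    r = r' ∨ (r = .row07 ∧ r' = .row08) ∨ (r = .row08 ∧ r' = .row07) := by
  cases r <;> cases r' <;> first | exact .inl rfl | exact .inr (.inl ⟨rfl, rfl⟩) |
    exact .inr (.inr ⟨rfl, rfl⟩) | (cases h1; done) | (cases h2; done) |
    (exfalso; revert h4; decide) | (exfalso; revert h3; decide)

theorem TableRow.eq_of_decType {r r' : TableRow} (h1 : r.first = r'.first)
    (h2 : r.second = r'.second) (h3 : r.decType = r'.decType)
    (h : r ∉ ({.row06, .row07, .row08, .row12, .row13} : Set TableRow)) : r = r' := by
  cases r <;> cases r' <;> first | rfl | (cases h1; done) | (cases h2; done) |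
    (exfalso; revert h3; decide) | exact absurd (by simp) h

/-! ### The quartics -/

section Quartics

variable {M : Type*} [Field M] {Ω : Type*} [Field Ω] [Algebra M Ω]

theorem quartic_natDegree (a b : M) : (quartic a b).natDegree = 4 := by
  unfold quartic
  compute_degree!

theorem quartic_monic (a b : M) : (quartic a b).Monic := by
  unfold quartic
  monicity!

/-- A finite field has only cyclic extensions. -/
theorem infinite_of_gal {f : M[X]} (h : QuarticType.S4.Is f.Gal ∨ QuarticType.A4.Is f.Gal) :
    Infinite M := by
  by_contra hM
  have : Finite M := not_infinite_iff_finite.1 hM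
  have : Finite f.SplittingField := Module.finite_of_finite M
  have hc : IsCyclic f.Gal := inferInstanceAs (IsCyclic Gal(f.SplittingField/M))
  have hcomm : ∀ x y : f.Gal, x * y = y * x := IsCyclic.isMulCommutative.is_comm.comm
  rcases h with ⟨⟨e⟩⟩ | ⟨⟨e⟩⟩
  · have h1 := congrArg e (hcomm (e.symm fourCycle) (e.symm transposition))
    rw [map_mul, map_mul, e.apply_symm_apply, e.apply_symm_apply] at h1
    exact absurd h1 (by decide)
  · let x : A4 := ⟨threeCycle, show threeCycle ∈ A4 by decide⟩
    let y : A4 := ⟨halfTurn, show halfTurn ∈ A4 by decide⟩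
    have h1 := congrArg e (hcomm (e.symm x) (e.symm y))
    rw [map_mul, map_mul, e.apply_symm_apply, e.apply_symm_apply] at h1
    have h2 : threeCycle * halfTurn = halfTurn * threeCycle := congrArg Subtype.val h1
    exact absurd h2 (by decide)

theorem IsRootOrdering.exists_apply_eq [IsAlgClosed Ω] [Normal M Ω] {n : ℕ} {f : M[X]}
    {α : Fin n → Ω} (h : IsRootOrdering f α) (hf : Irreducible f) (i j : Fin n) :
    ∃ σ : Gal(Ω/M), σ (α i) = α j := by
  have hroot (i : Fin n) : aeval (α i) f = 0 :=
    aeval_eq_zero_of_mem_rootSet (h.mem_rootSet.2 ⟨i, rfl⟩)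
  have hmin : IsConjRoot M (α j) (α i) := by
    rw [isConjRoot_def, ← minpoly.eq_of_irreducible_of_monic hf (hroot i) h.monic,
      ← minpoly.eq_of_irreducible_of_monic hf (hroot j) h.monic]
  exact isConjRoot_iff_exists_algEquiv.1 hmin

theorem IsRootOrdering.hom_eq_one_iff {n : ℕ} {f : M[X]} {α : Fin n → Ω}
    (h : IsRootOrdering f α) (hf : f.Separable) {ρ : Gal(Ω/M) →* Equiv.Perm (Fin n)}
    (hρ : ∀ σ i, σ (α i) = α (ρ σ i)) (σ : Gal(Ω/M)) :
    ρ σ = 1 ↔ ∀ x ∈ f.rootSet Ω, σ x = x := by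
  constructor
  · intro hσ x hx
    obtain ⟨i, rfl⟩ := h.mem_rootSet.1 hx
    rw [hρ, hσ, Equiv.Perm.one_apply]
  · intro hσ
    ext1 i
    apply h.injective hf
    rw [← hρ, hσ _ (h.mem_rootSet.2 ⟨i, rfl⟩), Equiv.Perm.one_apply]

/-- The degree of the intersection of the splitting fields in a correct row. -/
theorem TableRow.Holds.finrank_eq [IsAlgClosed Ω] {f g : M[X]} (hf : f.Separable) {D : Multiset ℕ}
    {r : TableRow} (h : r.Holds Ω f g D) :
    Module.finrank M (splittingFieldIn Ω f ⊓ splittingFieldIn Ω g : IntermediateField M Ω) =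
      r.degree := by
  obtain ⟨h1, -, -, h4, -⟩ := h
  have hgal := isGalois_splittingFieldIn (Ω := Ω) hf
  have hfin := finrank_splittingFieldIn (Ω := Ω) f
  rw [h1.card_eq] at hfin
  have hbot {K : IntermediateField M Ω} (hK : K = ⊥) : Module.finrank M K = 1 := by
    rw [hK, IntermediateField.finrank_bot]
  have heq (hL : splittingFieldIn Ω f = splittingFieldIn Ω g) :
      Module.finrank M (splittingFieldIn Ω f ⊓ splittingFieldIn Ω g : IntermediateField M Ω) =
        r.first.card := by
    rw [← hL, inf_idem, hfin]
  cases r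
  case row04 => exact heq h4
  case row16 => exact heq h4
  case row10 => exact hbot h4.2
  case row12 => exact hbot h4.2
  all_goals first | exact h4 | exact hbot h4

/-- The fourth column follows from the degree of the intersection. -/
theorem TableRow.hasIntersection_of_degree [IsAlgClosed Ω] {f g : M[X]} (hf : f.Separable)
    (hg : g.Separable) {r : TableRow} (h1 : r.first.Is f.Gal) (h2 : r.second.Is g.Gal)
    (h : Module.finrank M
      (splittingFieldIn Ω f ⊓ splittingFieldIn Ω g : IntermediateField M Ω) = r.degree) :
    r.HasIntersection (splittingFieldIn Ω f) (splittingFieldIn Ω g) := by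
  have := isGalois_splittingFieldIn (Ω := Ω) hf
  have := isGalois_splittingFieldIn (Ω := Ω) hg
  have := finiteDimensional_splittingFieldIn (Ω := Ω) f
  have := finiteDimensional_splittingFieldIn (Ω := Ω) g
  have hF := finrank_splittingFieldIn (Ω := Ω) f
  have hG := finrank_splittingFieldIn (Ω := Ω) g
  rw [h1.card_eq] at hF
  rw [h2.card_eq] at hG
  have hbot (hd : r.degree = 1) : splittingFieldIn Ω f ⊓ splittingFieldIn Ω g = ⊥ := by
    rw [← IntermediateField.finrank_eq_one_iff, h, hd]
  have hne (hc : r.first.card ≠ r.second.card) :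
      splittingFieldIn Ω f ≠ splittingFieldIn Ω g := fun e => hc (by rw [← hF, e, hG])
  have heq (hd : r.degree = r.first.card) (hd' : r.degree = r.second.card) :
      splittingFieldIn Ω f = splittingFieldIn Ω g := by
    have e1 := IntermediateField.eq_of_le_of_finrank_eq
      (inf_le_left : splittingFieldIn Ω f ⊓ splittingFieldIn Ω g ≤ _) (by rw [h, hF, hd])
    have e2 := IntermediateField.eq_of_le_of_finrank_eq
      (inf_le_right : splittingFieldIn Ω f ⊓ splittingFieldIn Ω g ≤ _) (by rw [h, hG, hd'])
    exact e1.symm.trans e2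
  cases r
  case row04 => exact heq rfl rfl
  case row16 => exact heq rfl rfl
  case row10 => exact ⟨hne (by decide), hbot rfl⟩
  case row12 => exact ⟨hne (by decide), hbot rfl⟩
  all_goals first | exact hbot rfl | exact h

theorem TableRow.Holds.unique [IsAlgClosed Ω] {f g : M[X]} (hf : f.Separable) {D : Multiset ℕ}
    {r r' : TableRow} (h : r.Holds Ω f g D) (h' : r'.Holds Ω f g D) : r = r' := by
  rcases TableRow.eq_of_entries (h.1.unique h'.1) (h.2.1.unique h'.2.1)
    (h.2.2.2.2.trans h'.2.2.2.2.symm) ((h.finrank_eq hf).symm.trans (h'.finrank_eq hf)) with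
    e | ⟨rfl, rfl⟩ | ⟨rfl, rfl⟩
  · exact e
  · exact (not_A4C4_C2_and_A4V4_C2 h.2.2.1 h'.2.2.1).elim
  · exact (not_A4C4_C2_and_A4V4_C2 h'.2.2.1 h.2.2.1).elim

/-- A row fits the Galois group of the product of two quartics, as a group of permutations of the
roots; `D` is the multiset of the degrees of the factors of every squarefree resolvent. -/
theorem exists_holds [IsAlgClosed Ω] [Normal M Ω] {f g : M[X]} (hf : f.Separable)
    (hg : g.Separable) (hirr : Irreducible g) {α β : Fin 4 → Ω} (hα : IsRootOrdering f α)
    (hβ : IsRootOrdering g β)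
    (hG : QuarticType.S4.Is f.Gal ∨ QuarticType.A4.Is f.Gal)
    (hcard : Nat.card g.Gal ≤ Nat.card f.Gal) :
    ∃ r : TableRow, r.Holds Ω f g r.decType ∧ ∀ (c d R : M[X]),
      R.map (algebraMap M Ω) = ∏ π, (X - C (resolventValue α β c d π)) → Squarefree R →
        factorDegrees R = r.decType := by
  obtain ⟨ρ, hρ⟩ := hα.exists_hom hf
  obtain ⟨τ, hτ⟩ := hβ.exists_hom hg
  -- The joint action on both sets of roots: the group to be classified.
  let H := (ρ.prod τ).range
  have hfst : H.map (MonoidHom.fst S4 S4) = ρ.range := by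
    rw [MonoidHom.map_range, MonoidHom.fst_comp_prod]
  have hsnd : H.map (MonoidHom.snd S4 S4) = τ.range := by
    rw [MonoidHom.map_range, MonoidHom.snd_comp_prod]
  obtain ⟨ef⟩ := nonempty_gal_mulEquiv_range f ρ (hα.hom_eq_one_iff hf hρ)
  obtain ⟨eg⟩ := nonempty_gal_mulEquiv_range g τ (hβ.hom_eq_one_iff hg hτ)
  obtain ⟨efg⟩ : Nonempty ((f * g).Gal ≃* H) := by
    refine nonempty_gal_mulEquiv_range (f * g) (ρ.prod τ) fun σ => ?_
    rw [rootSet_mul (mul_ne_zero hf.ne_zero hg.ne_zero), MonoidHom.prod_apply, Prod.mk_eq_one,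
      hα.hom_eq_one_iff hf hρ, hβ.hom_eq_one_iff hg hτ]
    simp only [Set.mem_union, or_imp, forall_and]
  have cf := Nat.card_congr ef.toEquiv
  have cg := Nat.card_congr eg.toEquiv
  have cfg := Nat.card_congr efg.toEquiv
  obtain ⟨r, hr⟩ : ∃ r, Fits H r := by
    apply exists_fits
    · rw [hfst]
      rcases hG with hG | hG
      · exact .inl (eq_top_of_card (cf.symm.trans hG.card_eq))
      · exact .inr (eq_A4_of_card (cf.symm.trans hG.card_eq))
    · intro i j
      obtain ⟨σ, hσ⟩ := hβ.exists_apply_eq hirr i j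
      rw [hτ] at hσ
      exact ⟨τ σ, hsnd ▸ ⟨σ, rfl⟩, hβ.injective hg hσ⟩
    · rwa [hfst, hsnd, ← cf, ← cg]
  have h1 : r.first.Is f.Gal := by
    have := hr.first
    rw [hfst] at this
    exact this.congr ef.symm
  have h2 : r.second.Is g.Gal := by
    have := hr.second
    rw [hsnd] at this
    exact this.congr eg.symm
  refine ⟨r, ⟨h1, h2, hr.group.congr efg.symm, ?_, rfl⟩, fun c d R hR hsq => ?_⟩
  · apply TableRow.hasIntersection_of_degree hf hg h1 h2
    have e1 := card_gal_mul_card_gal (Ω := Ω) hf hg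
    have e2 := hr.degree
    rw [hfst, hsnd, ← cf, ← cg, ← cfg, e1, mul_comm] at e2
    have hpos : 0 < Nat.card (f * g).Gal := Nat.card_pos
    exact (Nat.eq_of_mul_eq_mul_left hpos e2).symm
  · have hsep := isSeparable_resolventValue (fun i => hα.isSeparable hf i)
      (fun i => hβ.isSeparable hg i) c d
    have hinj := injective_of_squarefree hsep hR hsq
    obtain ⟨κ, hκ, hm⟩ := hr.orbits
    rw [← hm]
    refine factorDegrees_eq hsep hR hsq κ fun π π' => ?_
    rw [hκ]
    constructor
    · rintro ⟨_, ⟨σ, rfl⟩, rfl⟩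
      exact ⟨σ, apply_resolventValue c d π (hρ σ) (hτ σ)⟩
    · rintro ⟨σ, hσ⟩
      rw [apply_resolventValue c d π (hρ σ) (hτ σ)] at hσ
      -- Squarefreeness enters here: equal values of the resolvent come from equal permutations.
      exact ⟨_, ⟨σ, rfl⟩, hinj hσ⟩

/-- The resolvents of Tschirnhausen transformations have coefficients in the base field. -/
theorem exists_map_eq_prod_resolventValue [IsAlgClosed Ω] [Normal M Ω] {f g : M[X]}
    (hf : f.Separable) (hg : g.Separable) {α β : Fin 4 → Ω} (hα : IsRootOrdering f α)
    (hβ : IsRootOrdering g β) (c d : M[X]) :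
    ∃ R : M[X], R.map (algebraMap M Ω) = ∏ π, (X - C (resolventValue α β c d π)) := by
  obtain ⟨ρ, hρ⟩ := hα.exists_hom hf
  obtain ⟨τ, hτ⟩ := hβ.exists_hom hg
  refine exists_map_eq_prod (isSeparable_resolventValue (fun i => hα.isSeparable hf i)
      (fun i => hβ.isSeparable hg i) c d) fun σ => ?_
  exact ⟨(Equiv.mulLeft (τ σ)).trans (Equiv.mulRight (ρ σ)⁻¹), fun π =>
    apply_resolventValue c d π (hρ σ) (hτ σ)⟩

theorem IsMultiResolvent.exists_resolventValue {f g f' g' R : M[X]} (hf : f.Separable)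
    (hg : g.Separable) (hfn : f.natDegree = 4) (hgn : g.natDegree = 4) {α β : Fin 4 → Ω}
    (hα : IsRootOrdering f α) (hβ : IsRootOrdering g β) (hf' : IsTschirnhausen Ω f f')
    (hg' : IsTschirnhausen Ω g g') (hR : IsMultiResolvent Ω f' g' R) :
    ∃ c d : M[X], R.map (algebraMap M Ω) = ∏ π, (X - C (resolventValue α β c d π)) := by
  obtain ⟨α', β', hα', hβ', hR⟩ := hR
  obtain ⟨c, p, hp⟩ := hf'.exists_aeval hf hfn hα hα'
  obtain ⟨d, q, hq⟩ := hg'.exists_aeval hg hgn hβ hβ'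
  refine ⟨c, d, ?_⟩
  rw [hR, funext hp, funext hq, rootResolvent_perm]

theorem rootResolvent_aeval (α β : Fin 4 → Ω) (c d : M[X]) :
    rootResolvent (fun i => aeval (α i) c) (fun i => aeval (β i) d) =
      ∏ π, (X - C (resolventValue α β c d π)) :=
  rootResolvent_perm c d 1 1

theorem isTschirnhausen_self {f : M[X]} {α : Fin 4 → Ω} (hf : f.Separable)
    (hn : f.natDegree = 4) (hα : IsRootOrdering f α) : IsTschirnhausen Ω f f := by
  refine isTschirnhausen_of_aeval hn hα hf (c := X) ?_ (by simpa using hα)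
  rw [degree_eq_natDegree hf.ne_zero, hn, degree_X]
  norm_num

theorem exists_isDecompositionType [IsAlgClosed Ω] [Normal M Ω] [Infinite M] {f g : M[X]}
    (hf : f.Separable) (hg : g.Separable) (hfn : f.natDegree = 4) (hgn : g.natDegree = 4)
    {α β : Fin 4 → Ω} (hα : IsRootOrdering f α) (hβ : IsRootOrdering g β) :
    ∃ D, IsDecompositionType Ω f g D := by
  obtain ⟨d, hd, hβd, hinj⟩ := exists_tschirnhausen_poly (M := M) (hα.injective hf)
    (hβ.injective hg)
  obtain ⟨τ, hτ⟩ := hβ.exists_hom hg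
  obtain ⟨g', hg'⟩ := exists_map_eq_prod (M := M) (r := fun i => aeval (β i) d)
    (fun i => isSeparable_aeval (hβ.isSeparable hg i) d)
    fun σ => ⟨τ σ, fun i => by
      rw [← hτ, ← AlgEquiv.coe_toAlgHom, ← aeval_algHom_apply]⟩
  obtain ⟨R, hR⟩ := exists_map_eq_prod_resolventValue hf hg hα hβ X d
  refine ⟨factorDegrees R, f, g', R, isTschirnhausen_self hf hfn hα,
    isTschirnhausen_of_aeval hgn hβ (separable_of_map_eq_prod hg' hβd) ?_ hg',
    ⟨α, fun i => aeval (β i) d, hα, hg', ?_⟩, (separable_of_map_eq_prod hR hinj).squarefree, rfl⟩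
  · rw [degree_eq_natDegree hg.ne_zero, hgn]
    exact hd
  · rw [hR, ← rootResolvent_aeval]
    simp

end Quartics

end QuarticIntersection

open QuarticIntersection
/-- In the last clause of the conclusion, the Galois groups of the two quartics and the decomposition type `D`
determine the row, up to the ambiguity between rows 6, 7, 8 and between rows 12, 13. -/
theorem theorem3p1 {M : Type*} [Field M] (h2 : (2 : M) ≠ 0)
    {Ω : Type*} [Field Ω] [Algebra M Ω] [IsAlgClosure M Ω]
    (a b a' b' : M)
    (hsep : (quartic a b).Separable) (hsep' : (quartic a' b').Separable)
    (hirr : Irreducible (quartic a b)) (hirr' : Irreducible (quartic a' b'))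
    (hG : QuarticType.S4.Is (quartic a b).Gal ∨ QuarticType.A4.Is (quartic a b).Gal)
    (hcard : Nat.card (quartic a' b').Gal ≤ Nat.card (quartic a b).Gal) :
    ∃ D : Multiset ℕ,
      (∀ D' : Multiset ℕ, IsDecompositionType Ω (quartic a b) (quartic a' b') D' ↔ D' = D) ∧
      (∃ R : M[X], IsMultiResolvent Ω (quartic a b) (quartic a' b') R ∧ R.natDegree = 24 ∧
        (Squarefree R → factorDegrees R = D)) ∧
      (∃! r : TableRow, r.Holds Ω (quartic a b) (quartic a' b') D) ∧
      (∀ r : TableRow,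
        r ∉ ({.row06, .row07, .row08, .row12, .row13} : Set TableRow) →
        r.first.Is (quartic a b).Gal → r.second.Is (quartic a' b').Gal → r.decType = D →
        r.Holds Ω (quartic a b) (quartic a' b') D) := by
  have : IsAlgClosed Ω := IsAlgClosure.isAlgClosed M
  have : Normal M Ω := IsAlgClosure.normal M Ω
  have : Infinite M := infinite_of_gal hG
  have hfn := quartic_natDegree a b
  have hgn := quartic_natDegree a' b'
  obtain ⟨α, hα⟩ := exists_isRootOrdering (Ω := Ω) (quartic_monic a b) hfn
  obtain ⟨β, hβ⟩ := exists_isRootOrdering (Ω := Ω) (quartic_monic a' b') hgn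
  obtain ⟨r, hr, hdeg⟩ := exists_holds hsep hsep' hirr' hα hβ hG hcard
  have hdt : ∀ D', IsDecompositionType Ω (quartic a b) (quartic a' b') D' → D' = r.decType := by
    rintro D' ⟨f', g', R, hf', hg', hR, hsq, rfl⟩
    obtain ⟨c, d, hcd⟩ := hR.exists_resolventValue hsep hsep' hfn hgn hα hβ hf' hg'
    exact hdeg c d R hcd hsq
  refine ⟨r.decType, fun D' => ⟨hdt D', ?_⟩, ?_, ⟨r, hr, fun r' hr' => hr'.unique hsep hr⟩, ?_⟩
  · rintro rfl
    -- Some decomposition type exists, and every one equals that of the row.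
    obtain ⟨D, hD⟩ := exists_isDecompositionType hsep hsep' hfn hgn hα hβ
    exact hdt D hD ▸ hD
  · obtain ⟨R, hR⟩ := exists_map_eq_prod_resolventValue hsep hsep' hα hβ X X
    refine ⟨R, ⟨α, β, hα, hβ, ?_⟩, ?_, hdeg X X R hR⟩
    · rw [hR, ← rootResolvent_aeval]
      simp
    · rw [← natDegree_map (algebraMap M Ω), hR,
        natDegree_prod_of_monic _ _ fun i _ => monic_X_sub_C _]
      simp only [natDegree_X_sub_C, Finset.sum_const, smul_eq_mul, mul_one, Finset.card_univ]
      rw [← Nat.card_eq_fintype_card, card_S4]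
  · intro r' hne h1' h2' h3'
    rwa [TableRow.eq_of_decType (h1'.unique hr.1) (h2'.unique hr.2.1) h3' hne]
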